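/- Let $F$ be a field. A $\pm$-vector in $F^r$ is a set $\pm\vec v=\{\vec v,-\vec v\}$ with $\vec v\in F^r$ nonzero. A finite set $\{\pm\vec v_1,\dots,\pm\vec v_k\}$ of $k$ distinct $\pm$-vectors is a *determinant-$1$ partial $\pm$-basis* of $F^r$ if $\{\vec v_1,\dots,\vec v_k\}$ is a subset of a basis of $F^r$ and, in case $k=r$, moreover $\det(\vec v_1\ \cdots\ \vec v_r)\in\{1,-1\}$. A set of $\pm$-vectors is an *augmented determinant-$1$ partial $\pm$-basis* of $F^r$ if its elements can be listed without repetition as $\pm\vec v_0,\dots,\pm\vec v_k$ with $k\ge 2$ so that $\{\pm\vec v_1,\dots,\pm\vec v_k\}$ is a determinant-$1$ partial $\pm$-basis and $\vec v_0=\lambda\vec v_1+\nu\vec v_2$ for some $\lambda,\nu\in\{1,-1\}$. Let $\mathrm{BDA}^{\pm}_r(F)$ be the simplicial complex whose simplices are the nonempty determinant-$1$ partial $\pm$-bases and the augmented determinant-$1$ partial $\pm$-bases of $F^r$, with inclusion of sets as the face relation. For $n,m\ge 0$ let $\vec e_1,\dots,\vec e_{n+m}$ be the standard basis of $F^{n+m}$,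 and let $\mathrm{BDA}^{\pm}_{n,m}(F)$ be the full subcomplex of the link of $\{\pm\vec e_1,\dots,\pm\vec e_m\}$ in $\mathrm{BDA}^{\pm}_{n+m}(F)$ (the link being all of $\mathrm{BDA}^{\pm}_{n}(F)$ if $m=0$) spanned by the vertices $\pm\vec w$ with $\vec w\notin\operatorname{span}(\vec e_1,\dots,\vec e_m)$. **Proposition.** For every field $F$ and all integers $n,m\ge 0$, the complex $\mathrm{BDA}^{\pm}_{n,m}(F)$ is $(n-2)$-connected. That is, its geometric realization (with the weak topology) is nonempty if $n\ge 1$, and $\pi_i$ of it is trivial for every base point and every integer $i$ with $0\le i\le n-2$. -/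

import Mathlib

open scoped Topology

/-! ### Geometric realization and connectivity -/

namespace PreAbstractSimplicialComplex

variable {V : Type*}

/-- The points of the geometric realization `|K|` in barycentric coordinates: functions `V → ℝ`
that are nonnegative, vanish outside a face `s` of `K`, and have coordinates on `s` summing
to `1`. -/
def Realization (K : PreAbstractSimplicialComplex V) : Type _ :=
  {x : V → ℝ // ∃ s ∈ K.faces, (∀ v, 0 ≤ x v) ∧ (∀ v, v ∉ s → x v = 0) ∧ ∑ v ∈ s, x v = 1}

open Classical in
/-- The inclusion of the closed geometric simplex spanned by a face `s` of `K` (extension of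
barycentric coordinates by zero). -/
noncomputable def faceMap (K : PreAbstractSimplicialComplex V) (s : K.faces) :
    stdSimplex ℝ (s : Finset V) → K.Realization := fun x =>
  ⟨fun v => if h : v ∈ (s : Finset V) then x.1 ⟨v, h⟩ else 0, s.1, s.2, fun v => by
      by_cases h : v ∈ (s : Finset V)
      · simpa [h] using x.2.1 ⟨v, h⟩
      · simp [h], fun v hv => by simp [hv], by
      rw [← Finset.sum_coe_sort]
      simpa using x.2.2⟩

/-- The weak (coherent) topology on `|K|`: a set is open (closed) if and only if its preimage in
every closed simplex is open (closed) for the Euclidean topology of that simplex. -/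
noncomputable instance (K : PreAbstractSimplicialComplex V) : TopologicalSpace K.Realization :=
  ⨆ s : K.faces, TopologicalSpace.coinduced (K.faceMap s) inferInstance

open Classical in
/-- The link of `σ` in `K`: the simplices disjoint from `σ` whose union with `σ` is a simplex. For
`σ = ∅` this is `K` itself. -/
def link (K : PreAbstractSimplicialComplex V) (σ : Finset V) : PreAbstractSimplicialComplex V where
  faces := {τ | τ.Nonempty ∧ Disjoint τ σ ∧ τ ∪ σ ∈ K.faces}
  isRelLowerSet_faces := by
    rintro τ ⟨hne, hd, hK⟩
    refine ⟨hne, fun ρ hρ hρne => ⟨hρne, Finset.disjoint_of_subset_left hρ hd, ?_⟩⟩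
    exact (K.isRelLowerSet_faces hK).2 (Finset.union_subset_union_left hρ)
      (hρne.mono Finset.subset_union_left)

/-- The full subcomplex of `K` spanned by the vertices that lie in `W`. -/
def fullSubcomplex (K : PreAbstractSimplicialComplex V) (W : Set V) :
    PreAbstractSimplicialComplex V where
  faces := {τ | τ ∈ K.faces ∧ ∀ w ∈ τ, w ∈ W}
  isRelLowerSet_faces := by
    rintro τ ⟨hK, hW⟩
    exact ⟨(K.isRelLowerSet_faces hK).1, fun ρ hρ hρne =>
      ⟨(K.isRelLowerSet_faces hK).2 hρ hρne, fun w hw => hW w (hρ hw)⟩⟩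

end PreAbstractSimplicialComplex

/-- A space is `k`-connected (`k : ℤ`) if it is nonempty when `k ≥ -1`, and its homotopy groups
(set, for `i = 0`) `π_i(X, x)` are trivial for all `0 ≤ i ≤ k` and all base points `x`. There is no
condition for `k ≤ -2`. -/
def IsHighlyConnected (k : ℤ) (X : Type*) [TopologicalSpace X] : Prop :=
  (-1 ≤ k → Nonempty X) ∧ ∀ i : ℕ, (i : ℤ) ≤ k → ∀ x : X, Subsingleton (π_ i X x)

/-! ### Partial `±`-bases -/

namespace PMBasis

/-- A `±`-vector in `R^n`: a set `{v, -v}` with `v ≠ 0`. -/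
abbrev PMVector (R : Type*) [CommRing R] (n : ℕ) : Type _ :=
  {a : Set (Fin n → R) // ∃ v : Fin n → R, v ≠ 0 ∧ a = {v, -v}}

variable {R : Type*} [CommRing R] {n : ℕ}

/-- The `±`-vector `±v` of a nonzero vector `v`. -/
def pm (v : Fin n → R) (hv : v ≠ 0) : PMVector R n := ⟨{v, -v}, v, hv, rfl⟩

/-- A partial basis of `R^n`: a subset of a free basis. -/
def IsPartialBasis (T : Set (Fin n → R)) : Prop :=
  ∃ b : Module.Basis (Fin n) R (Fin n → R), T ⊆ Set.range b

/-- A partial `±`-basis: a finite set of `±`-vectors whose representatives form a partial basis. -/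
def IsPartialPMBasis (s : Finset (PMVector R n)) : Prop :=
  ∃ v : s → (Fin n → R), (∀ a : s, v a ∈ a.1.1) ∧ IsPartialBasis (Set.range v)

/-- A determinant-`1` partial `±`-basis: if it has exactly `n` elements, then the matrix with
columns any representatives, in any order, has determinant `1` or `-1`. (If it does not have `n`
elements, then there is no `e`, hence no condition.) -/
def IsDetOne (s : Finset (PMVector R n)) : Prop :=
  IsPartialPMBasis s ∧ ∀ (e : Fin n ≃ s) (v : Fin n → (Fin n → R)), (∀ i, v i ∈ (e i).1.1) →
    (Matrix.of fun i j => v j i).det = 1 ∨ (Matrix.of fun i j => v j i).det = -1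

open Classical in
/-- An augmented determinant-`1` partial `±`-basis: a set `{±v₀, ±v₁, …, ±v_k}` such that
`{±v₁, …, ±v_k}` is a determinant-`1` partial `±`-basis and `v₀ = c v₁ + d v₂` with
`c, d ∈ {1, -1}`. -/
def IsAugmentedDetOne (s : Finset (PMVector R n)) : Prop :=
  ∃ a₀ ∈ s, ∃ a₁ ∈ s.erase a₀, ∃ a₂ ∈ s.erase a₀, a₁ ≠ a₂ ∧ IsDetOne (s.erase a₀) ∧
    ∃ v₀ ∈ a₀.1, ∃ v₁ ∈ a₁.1, ∃ v₂ ∈ a₂.1, ∃ c ∈ ({1, -1} : Set R), ∃ d ∈ ({1, -1} : Set R),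
      v₀ = c • v₁ + d • v₂

/-! The next facts show that the simplices described above are closed under taking faces. -/

lemma eq_or_eq_neg {a : PMVector R n} {x y : Fin n → R} (hx : x ∈ a.1) (hy : y ∈ a.1) :
    x = y ∨ x = -y := by
  obtain ⟨a, v, hv, rfl⟩ := a
  simp only [Set.mem_insert_iff, Set.mem_singleton_iff] at hx hy
  rcases hx with rfl | rfl <;> rcases hy with rfl | rfl <;> simp

lemma eq_of_mem {a b : PMVector R n} {x : Fin n → R} (ha : x ∈ a.1) (hb : x ∈ b.1) : a = b := by
  obtain ⟨a, v, hv, rfl⟩ := a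
  obtain ⟨b, w, hw, rfl⟩ := b
  apply Subtype.ext
  simp only [Set.mem_insert_iff, Set.mem_singleton_iff] at ha hb
  rcases ha with rfl | rfl
  · rcases hb with rfl | rfl
    · rfl
    · simp [Set.pair_comm]
  · rcases hb with rfl | h
    · simp [Set.pair_comm]
    · simp [neg_injective h]

lemma IsPartialPMBasis.mono {s t : Finset (PMVector R n)} (hs : IsPartialPMBasis s) (h : t ⊆ s) :
    IsPartialPMBasis t := by
  obtain ⟨v, hv, b, hb⟩ := hs
  refine ⟨fun a => v ⟨a.1, h a.2⟩, fun a => hv ⟨a.1, h a.2⟩, b, ?_⟩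
  rintro _ ⟨a, rfl⟩
  exact hb ⟨_, rfl⟩

lemma IsPartialPMBasis.card_le {s : Finset (PMVector R n)} (hs : IsPartialPMBasis s) :
    s.card ≤ n := by
  obtain ⟨v, hv, b, hb⟩ := hs
  choose f hf using fun a : s => hb ⟨a, rfl⟩
  have hinj : Function.Injective f := by
    intro a a' h
    have : v a = v a' := by rw [← hf a, ← hf a', h]
    exact Subtype.ext (eq_of_mem (hv a) (this ▸ hv a'))
  simpa using Fintype.card_le_of_injective f hinj

lemma IsDetOne.mono {s t : Finset (PMVector R n)} (hs : IsDetOne s) (h : t ⊆ s) : IsDetOne t := by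
  refine ⟨hs.1.mono h, fun e v hv => ?_⟩
  have hc : t.card = n := by simpa using (Fintype.card_congr e).symm
  obtain rfl : t = s := Finset.eq_of_subset_of_card_le h (hs.1.card_le.trans hc.ge)
  exact hs.2 e v hv

lemma mem_of_sign {a : PMVector R n} {x : Fin n → R} {c : R} (hx : x ∈ a.1)
    (hc : c ∈ ({1, -1} : Set R)) : c • x ∈ a.1 := by
  obtain ⟨a, v, hv, rfl⟩ := a
  simp only [Set.mem_insert_iff, Set.mem_singleton_iff] at hx hc ⊢
  rcases hx with rfl | rfl <;> rcases hc with rfl | rfl <;> simp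

lemma exists_sign {a : PMVector R n} {x y : Fin n → R} (hx : x ∈ a.1) (hy : y ∈ a.1) :
    ∃ c ∈ ({1, -1} : Set R), x = c • y := by
  rcases eq_or_eq_neg hx hy with h | h
  · exact ⟨1, by simp, by simp [h]⟩
  · exact ⟨-1, by simp, by simp [h]⟩

lemma sign_mul {c d : R} (hc : c ∈ ({1, -1} : Set R)) (hd : d ∈ ({1, -1} : Set R)) :
    c * d ∈ ({1, -1} : Set R) := by
  simp only [Set.mem_insert_iff, Set.mem_singleton_iff] at hc hd ⊢
  rcases hc with rfl | rfl <;> rcases hd with rfl | rfl <;> simp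

open Classical in
/-- Exchange: if `v₀ = c v₁ + d v₂`, then `±v₁` may be replaced by `±v₀`. -/
lemma IsDetOne.exchange {s : Finset (PMVector R n)} {a₀ a₁ a₂ : PMVector R n} (h₀ : a₀ ∈ s)
    (h₁ : a₁ ∈ s.erase a₀) (h₂ : a₂ ∈ s.erase a₀) (h₁₂ : a₁ ≠ a₂) (hs : IsDetOne (s.erase a₀))
    {v₀ v₁ v₂ : Fin n → R} (hv₀ : v₀ ∈ a₀.1) (hv₁ : v₁ ∈ a₁.1) (hv₂ : v₂ ∈ a₂.1)
    {c d : R} (hc : c ∈ ({1, -1} : Set R)) (h : v₀ = c • v₁ + d • v₂) : IsDetOne (s.erase a₁) := by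
  have h01 : a₀ ≠ a₁ := (Finset.ne_of_mem_erase h₁).symm
  have h02 : a₀ ≠ a₂ := (Finset.ne_of_mem_erase h₂).symm
  have key : ∀ a, a ∈ s.erase a₁ → a ≠ a₀ → a ∈ s.erase a₀ := fun a ha h =>
    Finset.mem_erase.2 ⟨h, Finset.mem_of_mem_erase ha⟩
  constructor
  · obtain ⟨⟨v, hv, b, hb⟩, -⟩ := hs
    obtain ⟨c', hc', e1⟩ := exists_sign hv₁ (hv ⟨a₁, h₁⟩)
    obtain ⟨d', hd', e2⟩ := exists_sign hv₂ (hv ⟨a₂, h₂⟩)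
    obtain ⟨i₁, hi₁⟩ := hb ⟨⟨a₁, h₁⟩, rfl⟩
    obtain ⟨i₂, hi₂⟩ := hb ⟨⟨a₂, h₂⟩, rfl⟩
    have hi : i₁ ≠ i₂ := by
      rintro rfl
      have : v ⟨a₁, h₁⟩ = v ⟨a₂, h₂⟩ := hi₁.symm.trans hi₂
      exact h₁₂ (eq_of_mem (hv ⟨a₁, h₁⟩) (this ▸ hv ⟨a₂, h₂⟩))
    have e0 : v₀ = (c * c') • b i₁ + (d * d') • b i₂ := by
      rw [h, e1, e2, hi₁, hi₂, smul_smul, smul_smul]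
    have hdet : IsUnit (b.det (Function.update b i₁ v₀)) := by
      have : b.det (Function.update b i₁ v₀) = c * c' := by
        rw [e0, AlternatingMap.map_update_add, AlternatingMap.map_update_smul,
          AlternatingMap.map_update_smul, Function.update_eq_self,
          AlternatingMap.map_eq_zero_of_eq _ (Function.update b i₁ (b i₂)) (i := i₁) (j := i₂)
            (by simp [hi.symm]) hi, Module.Basis.det_self]
        simp
      rw [this]
      have := sign_mul hc hc'
      simp only [Set.mem_insert_iff, Set.mem_singleton_iff] at this
      rcases this with h | h <;> rw [h] <;> simp
    obtain ⟨hli, hsp⟩ := (Module.Basis.is_basis_iff_det b).2 hdet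
    refine ⟨fun a => if h : a.1 = a₀ then v₀ else v ⟨a.1, key _ a.2 h⟩, ?_,
      Module.Basis.mk hli hsp.ge, ?_⟩
    · rintro ⟨a, ha⟩
      by_cases h : a = a₀
      · subst h; simpa using hv₀
      · simpa [h] using hv ⟨a, key _ ha h⟩
    · rintro _ ⟨⟨a, ha⟩, rfl⟩
      rw [Module.Basis.coe_mk]
      by_cases h : a = a₀
      · exact ⟨i₁, by simp [h]⟩
      · obtain ⟨i, hi'⟩ := hb ⟨⟨a, key _ ha h⟩, rfl⟩
        refine ⟨i, ?_⟩
        have hne : i ≠ i₁ := by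
          rintro rfl
          have : v ⟨a, key _ ha h⟩ = v ⟨a₁, h₁⟩ := hi'.symm.trans hi₁
          exact Finset.ne_of_mem_erase ha
            (eq_of_mem (hv ⟨a, key _ ha h⟩) (this ▸ hv ⟨a₁, h₁⟩))
        simp [h, hne, hi']
  · intro e w hw
    have m₀ : a₀ ∈ s.erase a₁ := Finset.mem_erase.2 ⟨h01, h₀⟩
    have m₂ : a₂ ∈ s.erase a₁ := Finset.mem_erase.2 ⟨h₁₂.symm, Finset.mem_of_mem_erase h₂⟩
    set i₀ := e.symm ⟨a₀, m₀⟩ with hi₀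
    set i₂ := e.symm ⟨a₂, m₂⟩ with hi₂
    have hi : i₀ ≠ i₂ := by
      intro hh
      have := e.symm.injective hh
      exact h02 (congrArg Subtype.val this)
    have w0 : w i₀ ∈ a₀.1 := by simpa [hi₀] using hw i₀
    have w2 : w i₂ ∈ a₂.1 := by simpa [hi₂] using hw i₂
    obtain ⟨c', hc', e0⟩ := exists_sign w0 hv₀
    obtain ⟨d', hd', e2⟩ := exists_sign hv₂ w2
    let f : ↥(s.erase a₁) → ↥(s.erase a₀) := fun a =>
      if h : a.1 = a₀ then ⟨a₁, h₁⟩ else ⟨a.1, key _ a.2 h⟩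
    have finj : Function.Injective f := by
      rintro ⟨a, ha⟩ ⟨a', ha'⟩ hf
      have n1 := Finset.ne_of_mem_erase ha
      have n2 := Finset.ne_of_mem_erase ha'
      by_cases g : a = a₀ <;> by_cases g' : a' = a₀ <;> simp_all [f]
    have fbij : Function.Bijective f := by
      rw [Fintype.bijective_iff_injective_and_card]
      refine ⟨finj, ?_⟩
      simp [Finset.card_erase_of_mem h₀, Finset.card_erase_of_mem (Finset.mem_of_mem_erase h₁)]
    have hu := hs.2 (e.trans (Equiv.ofBijective f fbij)) (Function.update w i₀ v₁) (by
      intro i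
      by_cases g : i = i₀
      · subst g
        simpa [f, hi₀] using hv₁
      · have : (e i).1 ≠ a₀ := by
          intro hh
          apply g
          rw [hi₀, Equiv.eq_symm_apply]
          exact Subtype.ext hh
        simpa [f, g, this] using hw i)
    have hdet : ∀ u : Fin n → (Fin n → R), (Matrix.of fun i j => u j i).det =
        Matrix.detRowAlternating u := fun u => Matrix.det_transpose (Matrix.of u)
    rw [hdet] at hu ⊢
    have hw' : Matrix.detRowAlternating w =
        (c' * c) * Matrix.detRowAlternating (Function.update w i₀ v₁) := by
      have e3 : w i₀ = (c' * c) • v₁ + (c' * d * d') • w i₂ := by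
        rw [e0, h, e2, smul_add, smul_smul, smul_smul, smul_smul]
      conv_lhs => rw [← Function.update_eq_self i₀ w, e3]
      rw [AlternatingMap.map_update_add, AlternatingMap.map_update_smul,
        AlternatingMap.map_update_smul,
        AlternatingMap.map_eq_zero_of_eq _ (Function.update w i₀ (w i₂)) (i := i₀) (j := i₂)
          (by simp [hi.symm]) hi]
      simp
    rw [hw']
    have := sign_mul (sign_mul hc' hc) hu
    simpa using this

open Classical in
lemma IsAugmentedDetOne.subset {s t : Finset (PMVector R n)} (hs : IsAugmentedDetOne s)
    (h : t ⊆ s) : IsDetOne t ∨ IsAugmentedDetOne t := by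
  obtain ⟨a₀, h₀, a₁, h₁, a₂, h₂, h₁₂, hD, v₀, hv₀, v₁, hv₁, v₂, hv₂, c, hc, d, hd, e⟩ := hs
  by_cases t₀ : a₀ ∈ t
  · by_cases t₁ : a₁ ∈ t
    · by_cases t₂ : a₂ ∈ t
      · exact Or.inr ⟨a₀, t₀, a₁, Finset.mem_erase.2 ⟨Finset.ne_of_mem_erase h₁, t₁⟩, a₂,
          Finset.mem_erase.2 ⟨Finset.ne_of_mem_erase h₂, t₂⟩, h₁₂,
          hD.mono (Finset.erase_subset_erase _ h), v₀, hv₀, v₁, hv₁, v₂, hv₂, c, hc, d, hd, e⟩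
      · exact Or.inl ((hD.exchange h₀ h₂ h₁ h₁₂.symm hv₀ hv₂ hv₁ hd (by rw [e, add_comm])).mono
          (Finset.subset_erase.2 ⟨h, t₂⟩))
    · exact Or.inl ((hD.exchange h₀ h₁ h₂ h₁₂ hv₀ hv₁ hv₂ hc e).mono
        (Finset.subset_erase.2 ⟨h, t₁⟩))
  · exact Or.inl (hD.mono (Finset.subset_erase.2 ⟨h, t₀⟩))

/-! ### The complexes -/

/-- The complex `BDA^±_n(R)`: its simplices are the (nonempty) determinant-`1` partial `±`-bases and
augmented determinant-`1` partial `±`-bases of `R^n`. -/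
def BDA (R : Type*) [CommRing R] (n : ℕ) : PreAbstractSimplicialComplex (PMVector R n) where
  faces := {s | s.Nonempty ∧ (IsDetOne s ∨ IsAugmentedDetOne s)}
  isRelLowerSet_faces := by
    rintro s ⟨hne, hs⟩
    refine ⟨hne, fun t hts htne => ⟨htne, ?_⟩⟩
    rcases hs with hs | hs
    · exact Or.inl (hs.mono hts)
    · exact hs.subset hts

/-- The augmented link of `σ = {±v₁, …, ±v_k}` in `BDA^±_n(R)`: the full subcomplex of the link of
`σ` spanned by the vertices `±w` with `w` not in the span of `v₁, …, v_k`. -/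
def augmentedLink (σ : Finset (PMVector R n)) : PreAbstractSimplicialComplex (PMVector R n) :=
  ((BDA R n).link σ).fullSubcomplex
    {a | ∀ w ∈ a.1, w ∉ Submodule.span R (⋃ a' ∈ σ, a'.1)}

open Classical in
/-- The set `{±e₁, …, ±e_m}` of the first `m` standard `±`-vectors of `R^(n+m)`. -/
noncomputable def stdSimplexPM (R : Type*) [CommRing R] [Nontrivial R] (n m : ℕ) :
    Finset (PMVector R (n + m)) :=
  Finset.univ.image fun i : Fin m =>
    pm (Pi.single (Fin.castLE (Nat.le_add_left m n) i) (1 : R)) (by simp)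

/-- The complex `BDA^±_{n,m}(R)`: the augmented link of `{±e₁, …, ±e_m}` in `BDA^±_{n+m}(R)`. -/
noncomputable def BDARel (R : Type*) [CommRing R] [Nontrivial R] (n m : ℕ) :
    PreAbstractSimplicialComplex (PMVector R (n + m)) :=
  augmentedLink (stdSimplexPM R n m)

end PMBasis

/-! The complex is built from independence complexes by one gluing principle. Call a minimal simplex
of `K` outside a subcomplex `L` a core. If every simplex of `K` contains at most one core, then `K`
arises from `L` by attaching the star of each core `c` along its boundary, the join of the boundary
of `c` with its link. Hence `K` is `k`-connected as soon as `L` is and the link of each core `c` is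
`(k - |c|)`-connected (`Conn.glue`).

The principle is first applied to the independent subsets of a family spanning an `n`-dimensional
space (`conn_indepComplex`). Here `L` is the star of one index `t₀` with nonzero vector, which is a
cone. An independent set outside `L` spans the vector of `t₀`; its core consists of the indices with
nonzero coefficient in the expansion of that vector. The link of `c` is the independence complex of
a quotient of dimension `n - |c|`, so induction gives `(n - 2)`-connectedness. The determinant
condition removes only top-dimensional simplices, and over a field each of these is parallel to a
cone inside the smaller complex: for a basis of determinant `d`, the vector `d⁻¹` times the sum of
the vectors outside `σ` can replace any one of them to give determinant `1`. So the complex with the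
determinant condition is a retract (`Conn.of_retract`, `conn_detLink`). Finally, an augmented
simplex contains three `±`-vectors with a vanishing signed sum. Relative to `σ`, the core is this
triple minus `σ`, and its link is again of the form `detLink`, because deleting one vector of the
triple leaves a determinant-`1` partial basis with the same span (`conn_augmentedLink`).

The homotopy theory uses maps into finite subcomplexes that are continuous in barycentric
coordinates (`IsRMap`, `Conn`). For `Conn.glue_bdStar`, a sphere in `K` is pushed off the
barycenters of the cores and then, over a fine cubical grid, moved cell by cell into `L`: cells near
a barycenter are homotoped through the star into its boundary. Compact subsets of the weak topology
lie in finite subcomplexes, so `Conn` controls the homotopy groups of the realization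
(`Conn.isHighlyConnected`). -/

/-! ### Barycentric coordinates and combinatorial connectivity. -/

namespace PreAbstractSimplicialComplex

variable {V : Type*}

/-- The points of the realization of `K` in barycentric coordinates, as a set of functions. -/
def points (K : PreAbstractSimplicialComplex V) : Set (V → ℝ) :=
  {x | ∃ s ∈ K.faces, (∀ v, 0 ≤ x v) ∧ (∀ v, v ∉ s → x v = 0) ∧ ∑ v ∈ s, x v = 1}

lemma exists_support {K : PreAbstractSimplicialComplex V} {x : V → ℝ} (hx : x ∈ K.points) :
    ∃ s ∈ K.faces, (∀ v ∈ s, 0 < x v) ∧ (∀ v, v ∉ s → x v = 0) ∧ ∑ v ∈ s, x v = 1 := by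
  classical
  obtain ⟨s, hs, h0, hz, h1⟩ := hx
  have hsum : ∑ v ∈ s.filter (fun v => x v ≠ 0), x v = 1 := by
    rw [Finset.sum_filter_ne_zero, h1]
  refine ⟨s.filter (fun v => x v ≠ 0), (K.isRelLowerSet_faces hs).2 (Finset.filter_subset _ _) ?_,
    ?_, ?_, hsum⟩
  · rw [Finset.nonempty_iff_ne_empty]
    intro h
    rw [h] at hsum
    simp at hsum
  · intro v hv
    exact lt_of_le_of_ne (h0 v) (Finset.mem_filter.1 hv).2.symm
  · intro v hv
    by_cases hvs : v ∈ s
    · by_contra hne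
      exact hv (Finset.mem_filter.2 ⟨hvs, hne⟩)
    · exact hz v hvs

lemma points_nonneg {K : PreAbstractSimplicialComplex V} {x : V → ℝ} (hx : x ∈ K.points) (v : V) :
    0 ≤ x v := hx.choose_spec.2.1 v

lemma points_mono {K L : PreAbstractSimplicialComplex V} (h : K.faces ⊆ L.faces) :
    K.points ⊆ L.points := fun _ ⟨s, hs, hx⟩ => ⟨s, h hs, hx⟩

lemma vertex_mem_points {K : PreAbstractSimplicialComplex V} [DecidableEq V] {v : V}
    (hv : {v} ∈ K.faces) : Pi.single v (1 : ℝ) ∈ K.points :=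
  ⟨{v}, hv, fun w => by by_cases h : w = v <;> simp [h],
    fun w hw => by simp at hw; simp [hw], by simp⟩

lemma sum_eq_one_of_mem_points {K : PreAbstractSimplicialComplex V} {x : V → ℝ}
    (hx : x ∈ K.points) {s : Finset V} (hs : ∀ v ∉ s, x v = 0) : ∑ v ∈ s, x v = 1 := by
  obtain ⟨r, hr, h0, h1, h2⟩ := exists_support hx
  rw [← h2]
  symm
  apply Finset.sum_subset
  · intro v hv
    by_contra h
    exact (h0 v hv).ne' (hs v h)
  · intro v _ hv
    exact h1 v hv

/-- The segment between two points of a common simplex stays in that simplex. -/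
lemma segment_mem_points {K : PreAbstractSimplicialComplex V} {s : Finset V} (hs : s ∈ K.faces)
    {x y : V → ℝ} (hx : x ∈ K.points) (hy : y ∈ K.points) (hxs : ∀ v ∉ s, x v = 0)
    (hys : ∀ v ∉ s, y v = 0) {t : ℝ} (ht : t ∈ Set.Icc (0 : ℝ) 1) :
    (1 - t) • x + t • y ∈ K.points := by
  refine ⟨s, hs, fun v => ?_, fun v hv => by simp [hxs v hv, hys v hv], ?_⟩
  · have h1 := points_nonneg hx v
    have h2 := points_nonneg hy v
    have h3 : 0 ≤ 1 - t := by linarith [ht.2]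
    have h4 := ht.1
    simp only [Pi.add_apply, Pi.smul_apply, smul_eq_mul]
    positivity
  · simp only [Pi.add_apply, Pi.smul_apply, smul_eq_mul, Finset.sum_add_distrib, ← Finset.mul_sum,
      sum_eq_one_of_mem_points hx hxs, sum_eq_one_of_mem_points hy hys]
    ring

section RMap

variable {X : Type*} [TopologicalSpace X]

/-- `g` restricts to a map from `S` to the realization of `K` that has image in a finite subcomplex
and is continuous in barycentric coordinates. -/
structure IsRMap (K : PreAbstractSimplicialComplex V) (S : Set X) (g : X → V → ℝ) : Prop where
  finite : ∃ E : Finset V, ∀ x ∈ S, ∀ v ∉ E, g x v = 0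
  cont : ContinuousOn g S
  mem : ∀ x ∈ S, g x ∈ K.points

namespace IsRMap

variable {K L : PreAbstractSimplicialComplex V} {S T : Set X} {g g' : X → V → ℝ}

lemma mono (h : K.IsRMap S g) (hT : T ⊆ S) : K.IsRMap T g :=
  ⟨h.finite.imp fun _ hE x hx => hE x (hT hx), h.cont.mono hT, fun x hx => h.mem x (hT hx)⟩

lemma of_mem (h : K.IsRMap S g) (hL : ∀ x ∈ S, g x ∈ L.points) : L.IsRMap S g :=
  ⟨h.finite, h.cont, hL⟩

lemma le (h : K.IsRMap S g) (hL : K.faces ⊆ L.faces) : L.IsRMap S g :=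
  h.of_mem fun x hx => points_mono hL (h.mem x hx)

lemma congr (h : K.IsRMap S g) (he : Set.EqOn g' g S) : K.IsRMap S g' :=
  ⟨h.finite.imp fun _ hE x hx v hv => by rw [he hx, hE x hx v hv], h.cont.congr he,
    fun x hx => by rw [he hx]; exact h.mem x hx⟩

lemma comp {Y : Type*} [TopologicalSpace Y] (h : K.IsRMap S g) {φ : Y → X} {U : Set Y} (hφ : ContinuousOn φ U)
    (hU : Set.MapsTo φ U S) : K.IsRMap U (fun y => g (φ y)) :=
  ⟨h.finite.imp fun _ hE _ hy => hE _ (hU hy), h.cont.comp hφ hU, fun _ hy => h.mem _ (hU hy)⟩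

lemma union (hS : K.IsRMap S g) (hT : K.IsRMap T g) (cS : IsClosed S) (cT : IsClosed T) :
    K.IsRMap (S ∪ T) g := by
  classical
  obtain ⟨E, hE⟩ := hS.finite
  obtain ⟨E', hE'⟩ := hT.finite
  refine ⟨⟨E ∪ E', ?_⟩, hS.cont.union_of_isClosed hT.cont cS cT, ?_⟩
  · rintro x (hx | hx) v hv <;> simp only [Finset.mem_union, not_or] at hv
    · exact hE x hx v hv.1
    · exact hE' x hx v hv.2
  · rintro x (hx | hx)
    exacts [hS.mem x hx, hT.mem x hx]

lemma biUnion {α : Type*} (s : Finset α) (S : α → Set X) (hS : ∀ a ∈ s, K.IsRMap (S a) g)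
    (hc : ∀ a ∈ s, IsClosed (S a)) : K.IsRMap (⋃ a ∈ s, S a) g := by
  classical
  induction s using Finset.induction_on with
  | empty => exact ⟨⟨∅, by simp⟩, by simp, by simp⟩
  | insert a s _ ih =>
    rw [Finset.set_biUnion_insert]
    refine (hS a (by simp)).union (ih (fun b hb => hS b (by simp [hb]))
      (fun b hb => hc b (by simp [hb]))) (hc a (by simp)) ?_
    exact s.finite_toSet.isClosed_biUnion (fun b hb => hc b (by simp at hb; simp [hb]))

/-- Straight-line homotopies. -/
lemma segment (h : K.IsRMap S g) (h' : K.IsRMap S g')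
    (hs : ∀ x ∈ S, ∃ s ∈ K.faces, (∀ v ∉ s, g x v = 0) ∧ ∀ v ∉ s, g' x v = 0) :
    K.IsRMap (S ×ˢ Set.Icc (0 : ℝ) 1) (fun p : X × ℝ => (1 - p.2) • g p.1 + p.2 • g' p.1) := by
  classical
  obtain ⟨E, hE⟩ := h.finite
  obtain ⟨E', hE'⟩ := h'.finite
  refine ⟨⟨E ∪ E', ?_⟩, ?_, ?_⟩
  · rintro p hp v hv
    simp only [Finset.mem_union, not_or] at hv
    simp [hE p.1 hp.1 v hv.1, hE' p.1 hp.1 v hv.2]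
  · have c1 : ContinuousOn (fun p : X × ℝ => g p.1) (S ×ˢ Set.Icc (0 : ℝ) 1) :=
      h.cont.comp continuousOn_fst fun p hp => hp.1
    have c2 : ContinuousOn (fun p : X × ℝ => g' p.1) (S ×ˢ Set.Icc (0 : ℝ) 1) :=
      h'.cont.comp continuousOn_fst fun p hp => hp.1
    have c3 : ContinuousOn (fun p : X × ℝ => p.2) (S ×ˢ Set.Icc (0 : ℝ) 1) := continuousOn_snd
    exact ((continuousOn_const.sub c3).smul c1).add (c3.smul c2)
  · rintro p hp
    obtain ⟨s, hs, h1, h2⟩ := hs p.1 hp.1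
    exact segment_mem_points hs (h.mem _ hp.1) (h'.mem _ hp.1) h1 h2 hp.2

end IsRMap

end RMap

/-- Combinatorial `k`-connectedness: maps of spheres of dimension at most `k` into the realization
of `K` extend to balls. Spheres and balls are those of the supremum norm. -/
def Conn (k : ℤ) (K : PreAbstractSimplicialComplex V) : Prop :=
  ∀ (ι : Type) [Fintype ι], (Fintype.card ι : ℤ) ≤ k + 1 → ∀ g : (ι → ℝ) → V → ℝ,
    K.IsRMap (Metric.sphere 0 1) g →
      ∃ g' : (ι → ℝ) → V → ℝ, K.IsRMap (Metric.closedBall 0 1) g' ∧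
        Set.EqOn g' g (Metric.sphere 0 1)

lemma Conn.mono {k l : ℤ} {K : PreAbstractSimplicialComplex V} (h : K.Conn k) (hl : l ≤ k) :
    K.Conn l := fun ι _ hι => h ι (by omega)

/-- If a map of a sphere is homotopic to one that extends to the ball, then it extends itself. -/
lemma IsRMap.extend_of_homotopy {K : PreAbstractSimplicialComplex V} {ι : Type} [Fintype ι]
    {f F : (ι → ℝ) → V → ℝ} {H : (ι → ℝ) × ℝ → V → ℝ}
    (hH : K.IsRMap (Metric.sphere 0 1 ×ˢ Set.Icc (0 : ℝ) 1) H)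
    (h0 : ∀ x ∈ Metric.sphere (0 : ι → ℝ) 1, H (x, 0) = f x)
    (hF : K.IsRMap (Metric.closedBall 0 1) F)
    (h1 : ∀ x ∈ Metric.sphere (0 : ι → ℝ) 1, H (x, 1) = F x) :
    ∃ g : (ι → ℝ) → V → ℝ, K.IsRMap (Metric.closedBall 0 1) g ∧
      Set.EqOn g f (Metric.sphere 0 1) := by
  classical
  -- The inner half of the ball carries `F` at double scale; the outer shell carries the homotopy,
  -- with time `1` at radius `1 / 2` and time `0` at radius `1`.
  let g : (ι → ℝ) → V → ℝ := fun x =>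
    if ‖x‖ ≤ 1 / 2 then F ((2 : ℝ) • x) else H (‖x‖⁻¹ • x, 2 - 2 * ‖x‖)
  have hn : ∀ x : ι → ℝ, 1 / 2 ≤ ‖x‖ → ‖‖x‖⁻¹ • x‖ = 1 := by
    intro x hx
    rw [norm_smul, norm_inv, norm_norm, inv_mul_cancel₀]
    linarith
  have hA : K.IsRMap (Metric.closedBall 0 (1 / 2)) g := by
    refine (hF.comp (φ := fun x : ι → ℝ => (2 : ℝ) • x) (by fun_prop) ?_).congr ?_
    · intro x hx
      simp only [Metric.mem_closedBall, dist_zero_right, norm_smul] at hx ⊢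
      norm_num
      linarith
    · intro x hx
      simp only [Metric.mem_closedBall, dist_zero_right] at hx
      exact if_pos hx
  have hB : K.IsRMap {x : ι → ℝ | 1 / 2 ≤ ‖x‖ ∧ ‖x‖ ≤ 1} g := by
    refine (hH.comp (φ := fun x : ι → ℝ => (‖x‖⁻¹ • x, 2 - 2 * ‖x‖)) ?_ ?_).congr ?_
    · have hne : ∀ x ∈ {x : ι → ℝ | 1 / 2 ≤ ‖x‖ ∧ ‖x‖ ≤ 1}, ‖x‖ ≠ 0 := by
        rintro x ⟨hx, -⟩ h
        linarith
      exact ((continuous_norm.continuousOn.inv₀ hne).smul continuousOn_id).prodMk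
        (by fun_prop)
    · rintro x ⟨hx, hx'⟩
      refine ⟨?_, ?_, ?_⟩
      · simp only [mem_sphere_iff_norm, sub_zero]
        exact hn x hx
      · simp only; linarith
      · simp only; linarith
    · rintro x ⟨hx, hx'⟩
      by_cases h : ‖x‖ ≤ 1 / 2
      · have he : ‖x‖ = 1 / 2 := le_antisymm h hx
        have := h1 (‖x‖⁻¹ • x) (by simpa using hn x hx)
        simp only [g, if_pos h]
        rw [he] at this ⊢
        norm_num at this ⊢
        exact this.symm
      · exact if_neg h
  refine ⟨g, (hA.union hB Metric.isClosed_closedBall ?_).mono ?_, ?_⟩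
  · exact (isClosed_le continuous_const continuous_norm).inter
      (isClosed_le continuous_norm continuous_const)
  · intro x hx
    simp only [Metric.mem_closedBall, dist_zero_right] at hx
    rcases le_total ‖x‖ (1 / 2) with h | h
    · exact Or.inl (by simpa using h)
    · exact Or.inr ⟨h, hx⟩
  · intro x hx
    have hx' : ‖x‖ = 1 := by simpa using hx
    simp only [g, hx']
    norm_num
    exact h0 x hx

/-- Cones are contractible. -/
lemma Conn.of_cone [DecidableEq V] {K : PreAbstractSimplicialComplex V} {v : V}
    (hv : {v} ∈ K.faces) (h : ∀ s ∈ K.faces, insert v s ∈ K.faces) (k : ℤ) : K.Conn k := by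
  intro ι _ _ g hg
  have hb : ∀ S : Set (ι → ℝ), K.IsRMap S (fun _ : ι → ℝ => (Pi.single v (1 : ℝ) : V → ℝ)) :=
    fun S => ⟨⟨{v}, fun x _ w hw => by simp at hw; simp [hw]⟩, continuousOn_const,
      fun x _ => vertex_mem_points hv⟩
  refine IsRMap.extend_of_homotopy (hg.segment (hb _) ?_) (F := fun _ => Pi.single v 1) ?_ (hb _) ?_
  · intro x hx
    obtain ⟨s, hs, -, h0, -⟩ := exists_support (hg.mem x hx)
    refine ⟨insert v s, h s hs, fun w hw => h0 w fun h => hw (Finset.mem_insert_of_mem h),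
      fun w hw => ?_⟩
    have : w ≠ v := fun h => hw (by simp [h])
    simp [this]
  · intro x _
    simp
  · intro x _
    simp

end PreAbstractSimplicialComplex

/-! ### Cells of the integral cubical grid. -/

/-- A cell of the integral cubical grid in `κ → ℝ`: its lowest vertex and its directions. -/
abbrev GridCell (κ : Type) : Type := (κ → ℤ) × Finset κ

namespace GridCell

variable {κ : Type} [DecidableEq κ]

/-- The largest coordinates of a cell. -/
def upper (e : GridCell κ) (i : κ) : ℤ := e.1 i + if i ∈ e.2 then 1 else 0

/-- The closed cube of a cell. -/
def carrier (e : GridCell κ) : Set (κ → ℝ) := {x | ∀ i, (e.1 i : ℝ) ≤ x i ∧ x i ≤ e.upper i}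

/-- The face relation between cells. -/
def IsFace (e' e : GridCell κ) : Prop := ∀ i, e.1 i ≤ e'.1 i ∧ e'.upper i ≤ e.upper i

lemma IsFace.carrier_subset {e' e : GridCell κ} (h : e'.IsFace e) : e'.carrier ⊆ e.carrier := by
  intro x hx i
  have h1 : (e.1 i : ℝ) ≤ e'.1 i := by exact_mod_cast (h i).1
  have h2 : (e'.upper i : ℝ) ≤ e.upper i := by exact_mod_cast (h i).2
  exact ⟨h1.trans (hx i).1, (hx i).2.trans h2⟩

lemma IsFace.dirs_subset {e' e : GridCell κ} (h : e'.IsFace e) : e'.2 ⊆ e.2 := by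
  intro i hi
  by_contra hn
  have := h i
  simp only [upper, hi, hn, if_true, if_false] at this
  omega

lemma IsFace.eq_of_dirs_eq {e' e : GridCell κ} (h : e'.IsFace e) (h2 : e'.2 = e.2) : e' = e := by
  refine Prod.ext (funext fun i => ?_) h2
  have := h i
  simp only [upper, h2] at this
  omega

lemma isClosed_carrier (e : GridCell κ) : IsClosed e.carrier := by
  have : e.carrier = Set.Icc (fun i => (e.1 i : ℝ)) (fun i => (e.upper i : ℝ)) := by
    ext x
    simp [carrier, Pi.le_def, forall_and]
  rw [this]
  exact isClosed_Icc

/-- The lower (`b = 0`) and upper (`b = 1`) facet in a direction. -/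
def facet (e : GridCell κ) (i : κ) (b : ℤ) : GridCell κ :=
  (Function.update e.1 i (e.1 i + b), e.2.erase i)

lemma facet_isFace (e : GridCell κ) {i : κ} (hi : i ∈ e.2) {b : ℤ} (hb : b = 0 ∨ b = 1) :
    (e.facet i b).IsFace e := by
  intro j
  by_cases h : j = i
  · subst h
    simp only [facet, upper, Function.update_self, hi, if_true, Finset.mem_erase, ne_eq,
      not_true_eq_false, false_and, if_false]
    omega
  · simp [facet, upper, h]

lemma facet_ne (e : GridCell κ) {i : κ} (hi : i ∈ e.2) (b : ℤ) : e.facet i b ≠ e := by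
  intro h
  have : i ∈ (e.facet i b).2 := by rw [h]; exact hi
  simp [facet] at this

/-- The boundary of a cell. -/
def boundary (e : GridCell κ) : Set (κ → ℝ) :=
  {x | x ∈ e.carrier ∧ ∃ i ∈ e.2, x i = e.1 i ∨ x i = e.upper i}

lemma boundary_subset_facets (e : GridCell κ) {x : κ → ℝ} (hx : x ∈ e.boundary) :
    ∃ i ∈ e.2, ∃ b : ℤ, (b = 0 ∨ b = 1) ∧ x ∈ (e.facet i b).carrier := by
  obtain ⟨hx, i, hi, h⟩ := hx
  rcases h with h | h
  · refine ⟨i, hi, 0, by simp, fun j => ?_⟩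
    by_cases hj : j = i
    · subst hj
      simp [facet, upper, h]
    · simpa [facet, upper, hj] using hx j
  · refine ⟨i, hi, 1, by simp, fun j => ?_⟩
    by_cases hj : j = i
    · subst hj
      simp [facet, upper, h, hi]
    · simpa [facet, upper, hj] using hx j

/-- At a point of the relative interior of `e`, each coordinate in a direction of `e` lies strictly
between consecutive integers, so the bounds of `e'`, being integers, enclose that whole interval.
The other coordinates are integers and satisfy the bounds of `e'` themselves. -/
lemma isFace_of_mem {e e' : GridCell κ} {x : κ → ℝ} (hx : x ∈ e.carrier) (hb : x ∉ e.boundary)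
    (hx' : x ∈ e'.carrier) : e.IsFace e' := by
  have hb' : ∀ i ∈ e.2, x i ≠ e.1 i ∧ x i ≠ e.upper i := by
    intro i hi
    constructor <;> intro h
    · exact hb ⟨hx, i, hi, Or.inl h⟩
    · exact hb ⟨hx, i, hi, Or.inr h⟩
  intro i
  by_cases hi : i ∈ e.2
  · have h1 := lt_of_le_of_ne (hx i).1 (hb' i hi).1.symm
    have h2 := lt_of_le_of_ne (hx i).2 (hb' i hi).2
    have h3 : e'.1 i < e.upper i := by exact_mod_cast (hx' i).1.trans_lt h2
    have h4 : e.1 i < e'.upper i := by exact_mod_cast h1.trans_le (hx' i).2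
    simp only [upper, hi, if_true] at *
    split_ifs at * <;> omega
  · have h0 : x i = e.1 i := by
      have := hx i
      simp only [upper, hi, if_false, add_zero] at this
      exact le_antisymm this.2 this.1
    have h1 := hx' i
    rw [h0] at h1
    have h3 : e'.1 i ≤ e.1 i := by exact_mod_cast h1.1
    have h4 : e.1 i ≤ e'.upper i := by exact_mod_cast h1.2
    refine ⟨h3, ?_⟩
    simpa [upper, hi] using h4

end GridCell

lemma mem_sphere_pi {ι : Type*} [Fintype ι] {y : ι → ℝ} :
    y ∈ Metric.sphere (0 : ι → ℝ) 1 ↔ (∀ i, |y i| ≤ 1) ∧ ∃ i, |y i| = 1 := by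
  have hle : (∀ i, |y i| ≤ 1) ↔ ‖y‖ ≤ 1 := by
    rw [pi_norm_le_iff_of_nonneg zero_le_one]
    simp
  rw [mem_sphere_iff_norm, sub_zero, hle]
  constructor
  · intro h
    refine ⟨h.le, ?_⟩
    by_contra hne
    push Not at hne
    have : ‖y‖ < 1 := by
      rw [pi_norm_lt_iff zero_lt_one]
      intro i
      exact lt_of_le_of_ne (hle.2 h.le i) (hne i)
    linarith
  · rintro ⟨h, i, hi⟩
    refine le_antisymm h ?_
    rw [← hi]
    exact norm_le_pi_norm y i

lemma mem_closedBall_pi {ι : Type*} [Fintype ι] {y : ι → ℝ} :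
    y ∈ Metric.closedBall (0 : ι → ℝ) 1 ↔ ∀ i, |y i| ≤ 1 := by
  rw [mem_closedBall_iff_norm, sub_zero, pi_norm_le_iff_of_nonneg zero_le_one]
  simp

/-! ### Extending maps over a cubical grid. -/

namespace PreAbstractSimplicialComplex

open GridCell

variable {V : Type*} {κ : Type} [DecidableEq κ]

/-- The substitution `y = 2 (x - e) - 1` in the directions of `e` identifies the cell with the unit
ball of the supremum norm, and its boundary with the unit sphere. -/
lemma Conn.extend_cell {K : PreAbstractSimplicialComplex V} {e : GridCell κ}
    (hK : K.Conn (e.2.card - 1)) {h : (κ → ℝ) → V → ℝ} (hh : K.IsRMap e.boundary h) :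
    ∃ h', K.IsRMap e.carrier h' ∧ Set.EqOn h' h e.boundary := by
  let φ : (κ → ℝ) → (e.2 → ℝ) := fun x j => 2 * (x j - e.1 j) - 1
  let ψ : (e.2 → ℝ) → (κ → ℝ) := fun y i =>
    e.1 i + if hi : i ∈ e.2 then (y ⟨i, hi⟩ + 1) / 2 else 0
  have hφψ : ∀ x ∈ e.carrier, ψ (φ x) = x := by
    intro x hx
    ext i
    by_cases hi : i ∈ e.2
    · simp [φ, ψ, hi]
    · have := hx i
      simp only [upper, hi, if_false, add_zero] at this
      simp [ψ, hi, le_antisymm this.2 this.1]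
  have cφ : Continuous φ := by fun_prop
  have cψ : Continuous ψ := by
    refine continuous_pi fun i => ?_
    by_cases hi : i ∈ e.2
    · simp only [ψ, hi, dif_pos]
      fun_prop
    · simp only [ψ, hi, dif_neg, not_false_iff]
      fun_prop
  have mφ : ∀ x ∈ e.carrier, φ x ∈ Metric.closedBall (0 : e.2 → ℝ) 1 := by
    intro x hx
    rw [mem_closedBall_pi]
    rintro ⟨i, hi⟩
    have := hx i
    simp only [upper, hi, if_true] at this
    push_cast at this
    simp only [φ, abs_le]
    constructor <;> linarith
  have bφ : ∀ x ∈ e.boundary, φ x ∈ Metric.sphere (0 : e.2 → ℝ) 1 := by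
    rintro x ⟨hx, i, hi, h⟩
    rw [mem_sphere_pi]
    refine ⟨mem_closedBall_pi.1 (mφ x hx), ⟨i, hi⟩, ?_⟩
    simp only [φ]
    rcases h with h | h
    · rw [h]; norm_num
    · rw [h]; simp only [upper, hi, if_true]; push_cast; norm_num
  have bψ : ∀ y ∈ Metric.sphere (0 : e.2 → ℝ) 1, ψ y ∈ e.boundary := by
    intro y hy
    rw [mem_sphere_pi] at hy
    obtain ⟨hy, ⟨i, hi⟩, h⟩ := hy
    refine ⟨fun j => ?_, i, hi, ?_⟩
    · by_cases hj : j ∈ e.2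
      · have := abs_le.1 (hy ⟨j, hj⟩)
        simp only [ψ, upper, hj, dif_pos, if_true]
        push_cast
        constructor <;> linarith
      · simp [ψ, upper, hj]
    · simp only [ψ, upper, hi, dif_pos, if_true]
      rcases (abs_eq zero_le_one).1 h with h | h
      · right; rw [h]; push_cast; norm_num
      · left; rw [h]; norm_num
  obtain ⟨g, hg, hgs⟩ := hK e.2 (by simp) (fun y => h (ψ y))
    (hh.comp cψ.continuousOn fun y hy => bψ y hy)
  refine ⟨fun x => g (φ x), hg.comp cφ.continuousOn mφ, fun x hx => ?_⟩
  simp only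
  rw [hgs (bφ x hx)]
  simp only
  rw [hφψ x hx.1]

/-- Extension of maps over a finite cubical grid, where each new cell `e` is sent into a prescribed
complex `Y e` of sufficient connectivity. -/
theorem exists_grid_extension (P Q : Finset (GridCell κ)) (hQP : Q ⊆ P)
    (hP : ∀ e ∈ P, ∀ e', IsFace e' e → e' ∈ P) (hQ : ∀ e ∈ Q, ∀ e', IsFace e' e → e' ∈ Q)
    (Y : GridCell κ → PreAbstractSimplicialComplex V)
    (hY : ∀ e ∈ P, e ∉ Q → ∀ e' ∈ P, e' ∉ Q → IsFace e' e → (Y e').faces ⊆ (Y e).faces)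
    (hc : ∀ e ∈ P, e ∉ Q → (Y e).Conn (e.2.card - 1)) (h : (κ → ℝ) → V → ℝ)
    (hh : ∀ e ∈ P, e ∉ Q → ∀ e' ∈ Q, IsFace e' e → (Y e).IsRMap e'.carrier h) :
    ∃ h' : (κ → ℝ) → V → ℝ, (∀ e ∈ P, e ∉ Q → (Y e).IsRMap e.carrier h') ∧
      ∀ e ∈ Q, Set.EqOn h' h e.carrier := by
  classical
  induction P using Finset.strongInduction with
  | H P ih =>
  by_cases hPQ : P ⊆ Q
  · exact ⟨h, fun e he he' => (he' (hPQ he)).elim, fun e _ => fun _ _ => rfl⟩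
  -- A cell of largest dimension outside `Q` is not a proper face of any cell of `P`, so it can be
  -- filled last, after its boundary.
  obtain ⟨e, he, hmax⟩ := Finset.exists_max_image (P \ Q) (fun e => e.2.card)
    (Finset.sdiff_nonempty.2 hPQ)
  rw [Finset.mem_sdiff] at he
  obtain ⟨heP, heQ⟩ := he
  have htop : ∀ e' ∈ P, IsFace e e' → e' = e := by
    intro e' he' hf
    have h1 : e' ∉ Q := fun h => heQ (hQ e' h e hf)
    have h2 := hmax e' (Finset.mem_sdiff.2 ⟨he', h1⟩)
    exact (hf.eq_of_dirs_eq (Finset.eq_of_subset_of_card_le hf.dirs_subset h2)).symm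
  obtain ⟨g, hg, hgQ⟩ := ih (P.erase e) (Finset.erase_ssubset heP)
    (fun q hq => Finset.mem_erase.2 ⟨fun h => heQ (h ▸ hq), hQP hq⟩)
    (fun e₁ h₁ e₂ h₂ => by
      rw [Finset.mem_erase] at h₁ ⊢
      refine ⟨?_, hP e₁ h₁.2 e₂ h₂⟩
      rintro rfl
      exact h₁.1 (htop e₁ h₁.2 h₂))
    (fun e₁ h₁ n₁ e₂ h₂ n₂ hf => hY e₁ (Finset.mem_of_mem_erase h₁) n₁ e₂
      (Finset.mem_of_mem_erase h₂) n₂ hf)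
    (fun e₁ h₁ => hc e₁ (Finset.mem_of_mem_erase h₁))
    (fun e₁ h₁ => hh e₁ (Finset.mem_of_mem_erase h₁))
  have hbd : (Y e).IsRMap e.boundary g := by
    have : ∀ p ∈ e.2 ×ˢ ({0, 1} : Finset ℤ), (Y e).IsRMap (e.facet p.1 p.2).carrier g := by
      rintro ⟨i, b⟩ hp
      simp only [Finset.mem_product, Finset.mem_insert, Finset.mem_singleton] at hp
      have hf := e.facet_isFace hp.1 hp.2
      have hfP := hP e heP _ hf
      by_cases hfQ : e.facet i b ∈ Q
      · exact (hh e heP heQ _ hfQ hf).congr (hgQ _ hfQ)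
      · exact (hg _ (Finset.mem_erase.2 ⟨e.facet_ne hp.1 b, hfP⟩) hfQ).le
          (hY e heP heQ _ hfP hfQ hf)
    refine (IsRMap.biUnion _ _ this fun p _ => isClosed_carrier _).mono ?_
    intro x hx
    obtain ⟨i, hi, b, hb, hxb⟩ := e.boundary_subset_facets hx
    simp only [Set.mem_iUnion]
    exact ⟨(i, b), by simp [hi, hb], hxb⟩
  obtain ⟨g', hg', hgg'⟩ := (hc e heP heQ).extend_cell hbd
  -- Another cell of `P` meets `e` only in the boundary of `e`, where `g'` agrees with `g`;
  -- redefining the map on `e` therefore disturbs nothing else.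
  have hEq : ∀ e' ∈ P, e' ≠ e →
      Set.EqOn (fun x => if x ∈ e.carrier then g' x else g x) g e'.carrier := by
    intro e' he' hne x hx
    by_cases hxe : x ∈ e.carrier
    · simp only [hxe, if_true]
      apply hgg'
      by_contra hb
      exact hne (htop e' he' (isFace_of_mem hxe hb hx))
    · simp only [hxe, if_false]
  refine ⟨fun x => if x ∈ e.carrier then g' x else g x, ?_, ?_⟩
  · intro e' he' hn
    by_cases hee : e' = e
    · subst hee
      exact hg'.congr fun x hx => by simp [hx]
    · exact (hg e' (Finset.mem_erase.2 ⟨hee, he'⟩) hn).congr (hEq e' he' hee)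
  · intro q hq x hx
    rw [hEq q (hQP hq) (fun h => heQ (h ▸ hq)) hx]
    exact hgQ q hq hx

end PreAbstractSimplicialComplex

/-! ### Cores and stars. -/

namespace PreAbstractSimplicialComplex

variable {V : Type*}

/-- A core of the pair `(K, L)`: a minimal simplex of `K` that is not in `L`. -/
def IsCore (K L : PreAbstractSimplicialComplex V) (c : Finset V) : Prop :=
  c ∈ K.faces ∧ c ∉ L.faces ∧ ∀ c' ⊆ c, c' ∈ K.faces → c' ∉ L.faces → c' = c

lemma exists_core {K L : PreAbstractSimplicialComplex V} {s : Finset V} (hs : s ∈ K.faces)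
    (hL : s ∉ L.faces) : ∃ c, IsCore K L c ∧ c ⊆ s := by
  induction s using Finset.strongInduction with
  | H s ih =>
  by_cases h : ∀ c' ⊆ s, c' ∈ K.faces → c' ∉ L.faces → c' = s
  · exact ⟨s, ⟨hs, hL, h⟩, subset_rfl⟩
  · push Not at h
    obtain ⟨c', hc's, hc', hc'L, hne⟩ := h
    obtain ⟨c, hc, hcc'⟩ := ih c' (lt_of_le_of_ne hc's hne) hc' hc'L
    exact ⟨c, hc, hcc'.trans hc's⟩

lemma IsCore.nonempty {K L : PreAbstractSimplicialComplex V} {c : Finset V} (h : IsCore K L c) :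
    c.Nonempty := (K.isRelLowerSet_faces h.1).1

/-- A superset of a simplex outside `L` is outside `L`. -/
lemma notMem_faces_of_subset {L : PreAbstractSimplicialComplex V} {c s : Finset V}
    (hc : c.Nonempty) (hL : c ∉ L.faces) (hs : c ⊆ s) : s ∉ L.faces :=
  fun h => hL ((L.isRelLowerSet_faces h).2 hs hc)

open Classical in
/-- The closed star of `c`. -/
def star (K : PreAbstractSimplicialComplex V) (c : Finset V) : PreAbstractSimplicialComplex V where
  faces := {s | s.Nonempty ∧ s ∪ c ∈ K.faces}
  isRelLowerSet_faces := by
    rintro s ⟨hs, hK⟩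
    exact ⟨hs, fun t hts ht => ⟨ht, (K.isRelLowerSet_faces hK).2
      (Finset.union_subset_union_left hts) (ht.mono Finset.subset_union_left)⟩⟩

open Classical in
/-- The boundary of the star of `c`: the join of the boundary of `c` with its link. -/
def bdStar (K : PreAbstractSimplicialComplex V) (c : Finset V) :
    PreAbstractSimplicialComplex V where
  faces := {s | s.Nonempty ∧ s ∪ c ∈ K.faces ∧ ¬c ⊆ s}
  isRelLowerSet_faces := by
    rintro s ⟨hs, hK, hc⟩
    exact ⟨hs, fun t hts ht => ⟨ht, (K.isRelLowerSet_faces hK).2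
      (Finset.union_subset_union_left hts) (ht.mono Finset.subset_union_left),
      fun h => hc (h.trans hts)⟩⟩

lemma star_faces_subset (K : PreAbstractSimplicialComplex V) (c : Finset V) :
    (K.star c).faces ⊆ K.faces := by
  classical
  exact fun _ hs => (K.isRelLowerSet_faces hs.2).2 Finset.subset_union_left hs.1

lemma bdStar_faces_subset (K : PreAbstractSimplicialComplex V) (c : Finset V) :
    (K.bdStar c).faces ⊆ (K.star c).faces := fun _ hs => ⟨hs.1, hs.2.1⟩

/-- Any vertex of `c` is a cone point of the closed star. -/
lemma Conn.star {K : PreAbstractSimplicialComplex V} {c : Finset V} (hc : c ∈ K.faces) (k : ℤ) :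
    (K.star c).Conn k := by
  classical
  obtain ⟨v, hv⟩ := (K.isRelLowerSet_faces hc).1
  have h1 : {v} ∈ (K.star c).faces := by
    refine ⟨by simp, ?_⟩
    convert hc
    simpa using hv
  refine Conn.of_cone h1 ?_ k
  rintro s ⟨hs, hK⟩
  refine ⟨by simp, ?_⟩
  convert hK using 1
  ext w
  simp only [Finset.mem_union, Finset.mem_insert]
  constructor
  · rintro ((rfl | h) | h) <;> simp_all
  · rintro (h | h) <;> simp [h]

lemma mem_star_points {K : PreAbstractSimplicialComplex V} {c s : Finset V} {y : V → ℝ}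
    (hy : y ∈ K.points) (hs : s ∈ K.faces) (hcs : c ⊆ s) (hys : ∀ v ∉ s, y v = 0) :
    y ∈ (K.star c).points := by
  classical
  obtain ⟨r, hr, h0, h1, h2⟩ := exists_support hy
  have hrs : r ⊆ s := fun v hv => by
    by_contra h
    exact (h0 v hv).ne' (hys v h)
  refine ⟨r, ⟨(K.isRelLowerSet_faces hr).1, (K.isRelLowerSet_faces hs).2 ?_ ?_⟩,
    points_nonneg hy, h1, h2⟩
  · exact Finset.union_subset hrs hcs
  · exact (K.isRelLowerSet_faces hr).1.mono Finset.subset_union_left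

/-- The support of a point of `L` is a simplex of `L`, so it cannot contain the core `c`; this is
exactly what distinguishes the boundary of the star from the star. -/
lemma mem_bdStar_points {K L : PreAbstractSimplicialComplex V} {c : Finset V} {y : V → ℝ}
    (hc : IsCore K L c) (hy : y ∈ (K.star c).points) (hyL : y ∈ L.points) :
    y ∈ (K.bdStar c).points := by
  classical
  obtain ⟨r, hr, h0, h1, h2⟩ := exists_support hy
  obtain ⟨t, ht, h3, h4, -⟩ := exists_support hyL
  refine ⟨r, ⟨hr.1, hr.2, fun h => ?_⟩, points_nonneg hy, h1, h2⟩
  refine notMem_faces_of_subset hc.nonempty hc.2.1 (h.trans fun v hv => ?_) ht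
  by_contra hn
  exact (h0 v hv).ne' (h4 v hn)

/-- If `s` were outside `L` it would contain a core `c'`. Then `s ∪ c` contains both `c` and `c'`,
so uniqueness gives `c = c' ⊆ s`. -/
lemma bdStar_faces_subset_of_core {K L : PreAbstractSimplicialComplex V}
    (hu : ∀ s ∈ K.faces, ∀ c c', IsCore K L c → IsCore K L c' → c ⊆ s → c' ⊆ s → c = c')
    {c : Finset V} (hc : IsCore K L c) : (K.bdStar c).faces ⊆ L.faces := by
  classical
  rintro s ⟨hs, hK, hcs⟩
  by_contra hL
  obtain ⟨c', hc', hs'⟩ := exists_core ((K.isRelLowerSet_faces hK).2 Finset.subset_union_left hs) hL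
  refine hcs ?_
  rwa [hu _ hK c c' hc hc' Finset.subset_union_right (hs'.trans Finset.subset_union_left)]

/-! ### Pushing away from barycenters of cores -/

open Classical in
/-- The smallest coordinate of `x` on `c`. -/
noncomputable def minCoord (c : Finset V) (x : V → ℝ) : ℝ :=
  if h : c.Nonempty then c.inf' h x else 0

lemma continuous_minCoord (c : Finset V) : Continuous (minCoord c) := by
  unfold minCoord
  split_ifs with h
  · exact Continuous.finset_inf'_apply h fun i _ => continuous_apply i
  · exact continuous_const

lemma minCoord_le {c : Finset V} {v : V} (hv : v ∈ c) (x : V → ℝ) : minCoord c x ≤ x v := by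
  rw [minCoord, dif_pos ⟨v, hv⟩]
  exact Finset.inf'_le _ hv

lemma exists_minCoord_eq {c : Finset V} (hc : c.Nonempty) (x : V → ℝ) :
    ∃ v ∈ c, minCoord c x = x v := by
  rw [minCoord, dif_pos hc]
  obtain ⟨v, hv, h⟩ := Finset.exists_mem_eq_inf' hc x
  exact ⟨v, hv, h⟩

lemma minCoord_nonneg {c : Finset V} {x : V → ℝ} (hx : ∀ v, 0 ≤ x v) : 0 ≤ minCoord c x := by
  unfold minCoord
  split_ifs with h
  · exact (Finset.le_inf'_iff _ _).2 fun v _ => hx v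
  · exact le_rfl

lemma minCoord_eq_zero {c s : Finset V} {x : V → ℝ} (hx : ∀ v, 0 ≤ x v) (hs : ∀ v ∉ s, x v = 0)
    (hc : ¬c ⊆ s) : minCoord c x = 0 := by
  obtain ⟨v, hv, hvs⟩ := Finset.not_subset.1 hc
  exact le_antisymm ((minCoord_le hv x).trans (hs v hvs).le) (minCoord_nonneg hx)

/-- The truncation of the smallest coordinate of `x` on `c`. -/
noncomputable def pushAmount (c : Finset V) (x : V → ℝ) : ℝ :=
  min (minCoord c x) (1 / (2 * c.card))

open Classical in
/-- The map that pushes points away from the barycenters of the simplices in `C`. -/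
noncomputable def push (C : Finset (Finset V)) (x : V → ℝ) (v : V) : ℝ :=
  (x v - ∑ c ∈ C, if v ∈ c then pushAmount c x else 0) / (1 - ∑ c ∈ C, c.card * pushAmount c x)

lemma continuous_pushAmount (c : Finset V) : Continuous (pushAmount c) :=
  (continuous_minCoord c).min continuous_const

/-- This bound is the reason for truncating at `1 / (2 |c|)`: when only one core contributes, the
denominator in `push` is at least `1 / 2`. -/
lemma card_mul_pushAmount_le (c : Finset V) (x : V → ℝ) : c.card * pushAmount c x ≤ 1 / 2 := by
  rcases Nat.eq_zero_or_pos c.card with h | h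
  · simp [h]
  · have : (0 : ℝ) < c.card := by exact_mod_cast h
    calc c.card * pushAmount c x ≤ c.card * (1 / (2 * c.card)) := by
          gcongr
          exact min_le_right _ _
      _ = 1 / 2 := by field_simp

lemma pushAmount_eq_zero {c s : Finset V} {x : V → ℝ} (hx : ∀ v, 0 ≤ x v) (hs : ∀ v ∉ s, x v = 0)
    (hc : ¬c ⊆ s) : pushAmount c x = 0 := by
  rw [pushAmount, minCoord_eq_zero hx hs hc]
  exact min_eq_left (by positivity)

section push

variable {K L : PreAbstractSimplicialComplex V} {C : Finset (Finset V)}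

lemma push_eq_self {x : V → ℝ} (h : ∀ c ∈ C, pushAmount c x = 0) : push C x = x := by
  classical
  ext v
  have h1 : (∑ c ∈ C, if v ∈ c then pushAmount c x else 0) = 0 :=
    Finset.sum_eq_zero fun c hc => by simp [h c hc]
  have h2 : ∑ c ∈ C, (c.card : ℝ) * pushAmount c x = 0 :=
    Finset.sum_eq_zero fun c hc => by simp [h c hc]
  unfold push
  rw [h2]
  simp only [sub_zero, div_one, sub_eq_self]
  convert h1

open Classical in
lemma push_eq_single {x : V → ℝ} {c : Finset V} (hc : c ∈ C)
    (h : ∀ c' ∈ C, c' ≠ c → pushAmount c' x = 0) :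
    (∀ v, push C x v = (x v - if v ∈ c then pushAmount c x else 0) /
      (1 - c.card * pushAmount c x)) ∧
    ∑ c ∈ C, (c.card : ℝ) * pushAmount c x = c.card * pushAmount c x := by
  have h2 : ∑ c ∈ C, (c.card : ℝ) * pushAmount c x = c.card * pushAmount c x :=
    Finset.sum_eq_single_of_mem c hc fun c' hc' hne => by simp [h c' hc' hne]
  refine ⟨fun v => ?_, h2⟩
  unfold push
  rw [h2, Finset.sum_eq_single_of_mem c hc fun c' hc' hne => by simp [h c' hc' hne]]

/-- Either no simplex of `C` matters at `x`, or exactly one does. -/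
lemma pushAmount_cases (hC : ∀ c ∈ C, IsCore K L c)
    (hu : ∀ s ∈ K.faces, ∀ c c', IsCore K L c → IsCore K L c' → c ⊆ s → c' ⊆ s → c = c')
    {x : V → ℝ} (hx : ∀ v, 0 ≤ x v) {s : Finset V} (hs : s ∈ K.faces) (h0 : ∀ v ∉ s, x v = 0) :
    ((∀ c ∈ C, ¬c ⊆ s) ∧ ∀ c ∈ C, pushAmount c x = 0) ∨
      ∃ c ∈ C, c ⊆ s ∧ ∀ c' ∈ C, c' ≠ c → pushAmount c' x = 0 := by
  by_cases h : ∀ c ∈ C, ¬c ⊆ s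
  · exact Or.inl ⟨h, fun c hc => pushAmount_eq_zero hx h0 (h c hc)⟩
  · push Not at h
    obtain ⟨c, hc, hcs⟩ := h
    refine Or.inr ⟨c, hc, hcs, fun c' hc' hne => pushAmount_eq_zero hx h0 fun h => hne ?_⟩
    exact hu s hs c' c (hC c' hc') (hC c hc) h hcs

/-- At most one core lies in `s`, so at most one term is nonzero. Subtracting the same amount from
the `|c|` coordinates of that core keeps them nonnegative, and the denominator is the remaining
mass. No coordinate outside `s` appears, so the push is joined to the identity by a straight line
inside `s`. -/
lemma push_spec (hC : ∀ c ∈ C, IsCore K L c)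
    (hu : ∀ s ∈ K.faces, ∀ c c', IsCore K L c → IsCore K L c' → c ⊆ s → c' ⊆ s → c = c')
    {x : V → ℝ} (hx : x ∈ K.points) {s : Finset V} (hs : s ∈ K.faces) (h0 : ∀ v ∉ s, x v = 0)
    (hsum : ∑ v ∈ s, x v = 1) :
    push C x ∈ K.points ∧ (∀ v ∉ s, push C x v = 0) ∧
      1 - ∑ c ∈ C, (c.card : ℝ) * pushAmount c x ≠ 0 := by
  classical
  have hn := points_nonneg hx
  rcases pushAmount_cases hC hu hn hs h0 with ⟨-, h⟩ | ⟨c, hc, hcs, h⟩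
  · rw [push_eq_self h, Finset.sum_eq_zero fun c hc => by simp [h c hc]]
    exact ⟨hx, h0, by norm_num⟩
  · obtain ⟨hp, hd⟩ := push_eq_single hc h
    rw [hd]
    have hle := card_mul_pushAmount_le c x
    have hpos : 0 < 1 - c.card * pushAmount c x := by linarith
    have hz : ∀ v ∉ s, push C x v = 0 := by
      intro v hv
      rw [hp v, h0 v hv, if_neg fun h => hv (hcs h)]
      simp
    refine ⟨⟨s, hs, fun v => ?_, hz, ?_⟩, hz, hpos.ne'⟩
    · rw [hp v]
      refine div_nonneg ?_ hpos.le
      split_ifs with hv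
      · have := (min_le_left (minCoord c x) (1 / (2 * c.card))).trans (minCoord_le hv x)
        exact sub_nonneg.2 this
      · simpa using hn v
    · simp_rw [hp]
      rw [← Finset.sum_div, Finset.sum_sub_distrib, hsum, Finset.sum_ite_mem,
        Finset.inter_eq_right.2 hcs, Finset.sum_const, nsmul_eq_mul, div_self hpos.ne']

/-- Below the threshold no truncation takes place, so a vertex of the core at which the minimum is
attained gets coordinate zero. The new support then contains no core and is a simplex of `L`. -/
lemma push_mem_of_le (hC : ∀ c ∈ C, IsCore K L c)
    (hu : ∀ s ∈ K.faces, ∀ c c', IsCore K L c → IsCore K L c' → c ⊆ s → c' ⊆ s → c = c')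
    {x : V → ℝ} (hx : x ∈ K.points) {s : Finset V} (hs : s ∈ K.faces) (h0 : ∀ v ∉ s, x v = 0)
    (hsum : ∑ v ∈ s, x v = 1) (hCs : ∀ c, IsCore K L c → c ⊆ s → c ∈ C)
    (hle : ∀ c ∈ C, 2 * c.card * minCoord c x ≤ 1) : push C x ∈ L.points := by
  classical
  have hn := points_nonneg hx
  obtain ⟨hpK, hp0, -⟩ := push_spec hC hu hx hs h0 hsum
  obtain ⟨r, hr, h3, h4, h5⟩ := exists_support hpK
  have hrs : r ⊆ s := fun v hv => by
    by_contra h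
    exact (h3 v hv).ne' (hp0 v h)
  refine ⟨r, ?_, points_nonneg hpK, h4, h5⟩
  by_contra hrL
  obtain ⟨c', hc', hc'r⟩ := exists_core hr hrL
  have hc'C := hCs c' hc' (hc'r.trans hrs)
  rcases pushAmount_cases hC hu hn hs h0 with ⟨h, -⟩ | ⟨c, hc, hcs, h⟩
  · exact h c' hc'C (hc'r.trans hrs)
  · obtain rfl := hu s hs c c' (hC c hc) hc' hcs (hc'r.trans hrs)
    obtain ⟨v, hv, hmin⟩ := exists_minCoord_eq hc'.nonempty x
    have hz : push C x v = 0 := by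
      rw [(push_eq_single hc h).1 v, if_pos hv, ← hmin, pushAmount, min_eq_left, sub_self, zero_div]
      have hcpos : (0 : ℝ) < c.card := by exact_mod_cast hc'.nonempty.card_pos
      rw [le_div_iff₀ (by positivity)]
      linarith [hle c hc]
    exact (h3 v (hc'r hv)).ne' hz

lemma continuousOn_push :
    ContinuousOn (push C) {x | 1 - ∑ c ∈ C, (c.card : ℝ) * pushAmount c x ≠ 0} := by
  classical
  refine continuousOn_pi.2 fun v => ?_
  unfold push
  refine ContinuousOn.div ?_ ?_ fun x hx => hx
  · refine ((continuous_apply v).sub (continuous_finsetSum _ fun c _ => ?_)).continuousOn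
    split_ifs
    · exact continuous_pushAmount c
    · exact continuous_const
  · exact (continuous_const.sub (continuous_finsetSum _ fun c _ =>
      continuous_const.mul (continuous_pushAmount c))).continuousOn

end push

end PreAbstractSimplicialComplex

/-! ### Gluing stars along their boundaries. -/

namespace PreAbstractSimplicialComplex

variable {V : Type*}

open GridCell

section prism

/-- The projection of the prism to the unit sphere. -/
noncomputable def prismProj {ι : Type} (N : ℕ) (x : Option ι → ℝ) (i : ι) : ℝ := x (some i) / N

lemma continuous_prismProj {ι : Type} (N : ℕ) : Continuous (prismProj N : (Option ι → ℝ) → ι → ℝ) := by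
  unfold prismProj
  fun_prop

lemma le_upper {κ : Type} [DecidableEq κ] (e : GridCell κ) (i : κ) : e.1 i ≤ e.upper i := by
  unfold upper
  split_ifs <;> omega

variable {ι : Type} [Fintype ι] [DecidableEq ι]

/-- The cells of the product of the boundary of the cube `[-N, N]^ι` with `[0, 1]`. -/
def prismCells (ι : Type) [Fintype ι] [DecidableEq ι] (N : ℕ) : Set (GridCell (Option ι)) :=
  {e | (∀ i : ι, -(N : ℤ) ≤ e.1 (some i) ∧ e.upper (some i) ≤ N) ∧ 0 ≤ e.1 none ∧
    e.upper none ≤ 1 ∧ ∃ i : ι, some i ∉ e.2 ∧ (e.1 (some i) = N ∨ e.1 (some i) = -N)}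

lemma prismCells_finite (N : ℕ) : (prismCells ι N).Finite := by
  refine ((Set.finite_Icc (fun _ => -(N : ℤ) - 1) (fun _ => (N : ℤ) + 1)).prod
    (Set.finite_univ (α := Finset (Option ι)))).subset ?_
  rintro e ⟨h1, h2, h3, -⟩
  refine ⟨⟨fun i => ?_, fun i => ?_⟩, Set.mem_univ _⟩ <;> rcases i with _ | i <;>
    simp only
  · omega
  · have := h1 i
    omega
  · have := le_upper e none
    omega
  · have := h1 i
    have := le_upper e (some i)
    omega

lemma prismCells_down {N : ℕ} {e e' : GridCell (Option ι)} (he : e ∈ prismCells ι N)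
    (hf : IsFace e' e) : e' ∈ prismCells ι N := by
  obtain ⟨h1, h2, h3, i, hi, h4⟩ := he
  refine ⟨fun j => ⟨(h1 j).1.trans (hf _).1, (hf _).2.trans (h1 j).2⟩, h2.trans (hf _).1,
    (hf _).2.trans h3, i, fun h => hi (hf.dirs_subset h), ?_⟩
  have := hf (some i)
  have h5 := le_upper e' (some i)
  simp only [upper, hi, if_false] at this
  unfold upper at h5
  omega

/-- Besides `none`, the direction normal to the facet of the cube that contains the cell is missing.
Thus cells at the top of the prism have dimension at most `|ι| - 1`, and there `(k -
1)`-connectedness suffices for filling. -/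
lemma card_dirs_lt_of_none {N : ℕ} {e : GridCell (Option ι)} (he : e ∈ prismCells ι N)
    (hn : none ∉ e.2) : e.2.card + 1 ≤ Fintype.card ι := by
  obtain ⟨-, -, -, i, hi, -⟩ := he
  have h1 : some i ∉ insert none e.2 := by simp [hi]
  have := Finset.card_lt_univ_of_notMem h1
  rw [Fintype.card_option, Finset.card_insert_of_notMem hn] at this
  omega

lemma prismProj_mem {N : ℕ} (hN : 0 < N) {e : GridCell (Option ι)} (he : e ∈ prismCells ι N)
    {x : Option ι → ℝ} (hx : x ∈ e.carrier) : prismProj N x ∈ Metric.sphere (0 : ι → ℝ) 1 := by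
  obtain ⟨h1, h2, h3, i, hi, h4⟩ := he
  have hN' : (0 : ℝ) < N := by exact_mod_cast hN
  rw [mem_sphere_pi]
  refine ⟨fun j => ?_, i, ?_⟩
  · have h5 : -(N : ℝ) ≤ e.1 (some j) := by exact_mod_cast (h1 j).1
    have h6 : (e.upper (some j) : ℝ) ≤ N := by exact_mod_cast (h1 j).2
    have := hx (some j)
    rw [prismProj, abs_div, abs_of_pos hN', div_le_one hN', abs_le]
    exact ⟨h5.trans this.1, this.2.trans h6⟩
  · have := hx (some i)
    simp only [upper, hi, if_false, add_zero] at this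
    have h7 := le_antisymm this.2 this.1
    rw [prismProj, h7]
    rcases h4 with h | h <;> rw [h]
    · simp [hN'.ne']
    · simp [hN'.ne']

/-- The cell has the floors of the coordinates as lowest vertex and the non-integral coordinates as
directions, so `none` is not a direction when `t` is `0` or `1`. -/
lemma exists_prismCell {N : ℕ} {y : ι → ℝ} (hy : y ∈ Metric.sphere (0 : ι → ℝ) 1)
    {t : ℝ} (ht : t ∈ Set.Icc (0 : ℝ) 1) :
    ∃ e ∈ prismCells ι N, (fun i : Option ι => i.elim t fun i => N * y i) ∈ e.carrier ∧
      (t = 1 → none ∉ e.2 ∧ e.1 none = 1) ∧ (t = 0 → none ∉ e.2 ∧ e.1 none = 0) := by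
  classical
  rw [mem_sphere_pi] at hy
  obtain ⟨hy, i, hi⟩ := hy
  set x : Option ι → ℝ := fun i => i.elim t fun i => N * y i with hx
  have hup : ∀ j, upper ((fun j => ⌊x j⌋, Finset.univ.filter fun j => (⌊x j⌋ : ℝ) < x j) :
      GridCell (Option ι)) j = ⌈x j⌉ := by
    intro j
    simp only [upper, Finset.mem_filter, Finset.mem_univ, true_and]
    split_ifs with h
    · have h1 := Int.lt_ceil.2 h
      have h2 := Int.ceil_le_floor_add_one (x j)
      omega
    · have h1 : (⌊x j⌋ : ℝ) = x j := le_antisymm (Int.floor_le _) (not_lt.1 h)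
      conv_rhs => rw [← h1]
      simp
  have hxi : ∀ j : ι, -(N : ℝ) ≤ x (some j) ∧ x (some j) ≤ N := by
    intro j
    have h1 := abs_le.1 (hy j)
    have h2 : (0 : ℝ) ≤ N := Nat.cast_nonneg N
    simp only [hx, Option.elim]
    constructor <;> nlinarith
  refine ⟨(fun j => ⌊x j⌋, Finset.univ.filter fun j => (⌊x j⌋ : ℝ) < x j), ⟨?_, ?_, ?_, i, ?_⟩,
    ?_, ?_, ?_⟩
  · intro j
    rw [hup]
    simp only [Int.le_floor, Int.ceil_le]
    push_cast
    exact hxi j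
  · simp only [Int.le_floor]
    simpa [hx] using ht.1
  · rw [hup, Int.ceil_le]
    simpa [hx] using ht.2
  · have h5 : x (some i) = ((N : ℤ) : ℝ) ∨ x (some i) = ((-N : ℤ) : ℝ) := by
      rcases (abs_eq zero_le_one).1 hi with h | h <;> simp [hx, h]
    rcases h5 with h | h
    · simp only [h, Finset.mem_filter, Int.floor_intCast]
      simp
    · simp only [h, Finset.mem_filter, Int.floor_intCast]
      simp
  · intro j
    rw [hup]
    exact ⟨Int.floor_le _, Int.le_ceil _⟩
  · rintro rfl
    simp [hx]
  · rintro rfl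
    simp [hx]

lemma dist_prismProj_lt {N : ℕ} (hN : 0 < N) {e : GridCell (Option ι)} {x y : Option ι → ℝ}
    (hx : x ∈ e.carrier) (hy : y ∈ e.carrier) :
    dist (prismProj N x) (prismProj N y) ≤ 1 / N := by
  have hN' : (0 : ℝ) < N := by exact_mod_cast hN
  rw [dist_pi_le_iff (by positivity)]
  intro i
  have h1 := hx (some i)
  have h2 := hy (some i)
  have h3 : (e.upper (some i) : ℝ) ≤ e.1 (some i) + 1 := by
    unfold upper
    split_ifs <;> push_cast <;> linarith
  rw [Real.dist_eq, prismProj, prismProj, ← sub_div, abs_div, abs_of_pos hN']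
  gcongr
  rw [abs_le]
  constructor <;> linarith

end prism

lemma carrier_nonempty {κ : Type} [DecidableEq κ] (e : GridCell κ) : ∃ x, x ∈ e.carrier := by
  refine ⟨fun i => e.1 i, fun i => ⟨le_rfl, ?_⟩⟩
  unfold upper
  split_ifs <;> simp

/-- The gluing theorem: `K` is obtained from a `k`-connected complex `L` by attaching the stars of
the cores along their boundaries, and those are `(k - 1)`-connected. -/
theorem Conn.glue_bdStar {K L : PreAbstractSimplicialComplex V} (hLK : L.faces ⊆ K.faces)
    (hu : ∀ s ∈ K.faces, ∀ c c', IsCore K L c → IsCore K L c' → c ⊆ s → c' ⊆ s → c = c')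
    {k : ℤ} (hL : L.Conn k) (hc : ∀ c, IsCore K L c → (K.bdStar c).Conn (k - 1)) : K.Conn k := by
  classical
  intro ι _ hι f hf
  obtain ⟨E, hE⟩ := hf.finite
  -- The image of `f` involves only the vertices in `E`, so only these finitely many cores matter.
  set C : Finset (Finset V) := E.powerset.filter (IsCore K L) with hCdef
  have hC : ∀ c ∈ C, IsCore K L c := fun c hc => (Finset.mem_filter.1 hc).2
  -- data of the push of a point of the sphere
  have hsupp : ∀ y ∈ Metric.sphere (0 : ι → ℝ) 1, ∃ s ∈ K.faces, (∀ v ∈ s, 0 < f y v) ∧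
      (∀ v ∉ s, f y v = 0) ∧ ∑ v ∈ s, f y v = 1 ∧ (∀ c, IsCore K L c → c ⊆ s → c ∈ C) := by
    intro y hy
    obtain ⟨s, hs, h1, h2, h3⟩ := exists_support (hf.mem y hy)
    refine ⟨s, hs, h1, h2, h3, fun c hc hcs => Finset.mem_filter.2 ⟨Finset.mem_powerset.2 ?_, hc⟩⟩
    intro v hv
    by_contra hvE
    exact (h1 v (hcs hv)).ne' (hE y hy v hvE)
  set f₁ : (ι → ℝ) → V → ℝ := fun y => push C (f y) with hf₁def
  have hf₁ : K.IsRMap (Metric.sphere 0 1) f₁ := by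
    refine ⟨⟨E, fun y hy v hv => ?_⟩, ?_, fun y hy => ?_⟩
    · obtain ⟨s, hs, h1, h2, h3, -⟩ := hsupp y hy
      refine (push_spec hC hu (hf.mem y hy) hs h2 h3).2.1 v fun hvs => ?_
      exact (h1 v hvs).ne' (hE y hy v hv)
    · refine continuousOn_push.comp hf.cont fun y hy => ?_
      obtain ⟨s, hs, h1, h2, h3, -⟩ := hsupp y hy
      exact (push_spec hC hu (hf.mem y hy) hs h2 h3).2.2
    · obtain ⟨s, hs, h1, h2, h3, -⟩ := hsupp y hy
      exact (push_spec hC hu (hf.mem y hy) hs h2 h3).1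
  -- a fine grid
  have hunif : UniformContinuousOn (fun y => fun c : C => 2 * (c.1.card : ℝ) * minCoord c.1 (f y))
      (Metric.sphere (0 : ι → ℝ) 1) := by
    refine (isCompact_sphere _ _).uniformContinuousOn_of_continuous (continuousOn_pi.2 fun c => ?_)
    exact continuousOn_const.mul ((continuous_minCoord c.1).comp_continuousOn hf.cont)
  -- The tolerance `1` is the threshold in `good`: on a bad cell some scaled minimum exceeds `1` at
  -- one point, hence is positive on the whole cell.
  obtain ⟨δ, hδ, hunif⟩ := Metric.uniformContinuousOn_iff.1 hunif 1 one_pos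
  obtain ⟨N, hN⟩ := exists_nat_one_div_lt hδ
  set M := N + 1 with hM
  have hM0 : 0 < M := Nat.succ_pos N
  have hMδ : 1 / (M : ℝ) < δ := by rw [hM]; exact_mod_cast hN
  let good : GridCell (Option ι) → Prop := fun e => ∀ x ∈ e.carrier, ∀ c ∈ C,
    2 * (c.card : ℝ) * minCoord c (f (prismProj M x)) ≤ 1
  have hbad : ∀ e ∈ prismCells ι M, ¬good e → ∃ c ∈ C, ∀ x ∈ e.carrier,
      0 < minCoord c (f (prismProj M x)) := by
    intro e he hg
    simp only [good] at hg
    push Not at hg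
    obtain ⟨x₀, hx₀, c, hc, hlt⟩ := hg
    refine ⟨c, hc, fun x hx => ?_⟩
    have h1 := hunif _ (prismProj_mem hM0 he hx) _ (prismProj_mem hM0 he hx₀)
      ((dist_prismProj_lt hM0 hx hx₀).trans_lt hMδ)
    rw [dist_pi_lt_iff one_pos] at h1
    have h2 := abs_lt.1 (h1 ⟨c, hc⟩)
    simp only at h2
    have h3 : 0 < 2 * (c.card : ℝ) * minCoord c (f (prismProj M x)) := by linarith
    exact pos_of_mul_pos_right h3 (by positivity)
  choose! cc hccC hcc using hbad
  have hsub : ∀ e ∈ prismCells ι M, ¬good e → ∀ x ∈ e.carrier, ∀ s : Finset V,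
      (∀ v ∉ s, f (prismProj M x) v = 0) → cc e ⊆ s := by
    intro e he hg x hx s hs
    by_contra h
    exact (hcc e he hg x hx).ne' (minCoord_eq_zero
      (points_nonneg (hf.mem _ (prismProj_mem hM0 he hx))) hs h)
  have hstar : ∀ e ∈ prismCells ι M, ¬good e → ∀ x ∈ e.carrier,
      f₁ (prismProj M x) ∈ (K.star (cc e)).points := by
    intro e he hg x hx
    have hy := prismProj_mem hM0 he hx
    obtain ⟨s, hs, h1, h2, h3, -⟩ := hsupp _ hy
    obtain ⟨h4, h5, -⟩ := push_spec hC hu (hf.mem _ hy) hs h2 h3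
    exact mem_star_points h4 hs (hsub e he hg x hx s h2) h5
  have hgoodL : ∀ e ∈ prismCells ι M, good e → ∀ x ∈ e.carrier,
      f₁ (prismProj M x) ∈ L.points := by
    intro e he hg x hx
    have hy := prismProj_mem hM0 he hx
    obtain ⟨s, hs, h1, h2, h3, h4⟩ := hsupp _ hy
    exact push_mem_of_le hC hu (hf.mem _ hy) hs h2 h3 h4 (hg x hx)
  -- At a point of the common face, the supporting simplex contains both cores, so they coincide.
  have hcceq : ∀ e ∈ prismCells ι M, ¬good e → ∀ e' ∈ prismCells ι M, ¬good e' → IsFace e' e →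
      cc e' = cc e := by
    intro e he hg e' he' hg' hf'
    obtain ⟨x, hx⟩ := carrier_nonempty e'
    obtain ⟨s, hs, -, h2, -⟩ := hsupp _ (prismProj_mem hM0 he' hx)
    exact hu s hs _ _ (hC _ (hccC e' he' hg')) (hC _ (hccC e he hg)) (hsub e' he' hg' x hx s h2)
      (hsub e he hg x (hf'.carrier_subset hx) s h2)
  -- the extension problem on the prism
  let P : Finset (GridCell (Option ι)) := (prismCells_finite M).toFinset
  have hPm : ∀ e, e ∈ P ↔ e ∈ prismCells ι M := fun e => Set.Finite.mem_toFinset _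
  -- The map is prescribed at the bottom of the prism and, constantly in time, over the good cells,
  -- where `f₁` already lies in `L`.
  let Q : Finset (GridCell (Option ι)) := P.filter fun e => good e ∨ (none ∉ e.2 ∧ e.1 none = 0)
  have hQm : ∀ e, e ∈ Q ↔ e ∈ prismCells ι M ∧ (good e ∨ (none ∉ e.2 ∧ e.1 none = 0)) :=
    fun e => by simp only [Q, Finset.mem_filter, hPm]
  have hQn : ∀ e, e ∈ prismCells ι M → e ∉ Q → ¬good e :=
    fun e he h hg => h ((hQm e).2 ⟨he, Or.inl hg⟩)
  -- Over a bad cell the homotopy moves inside the contractible star and must end in its boundary,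
  -- which lies in `L`.
  let Y : GridCell (Option ι) → PreAbstractSimplicialComplex V := fun e =>
    if none ∉ e.2 ∧ e.1 none = 1 then K.bdStar (cc e) else K.star (cc e)
  have hRf₁ : ∀ e ∈ prismCells ι M, K.IsRMap e.carrier fun x => f₁ (prismProj M x) :=
    fun e he => hf₁.comp (continuous_prismProj M).continuousOn fun x hx => prismProj_mem hM0 he hx
  obtain ⟨h', hh', hh'Q⟩ := exists_grid_extension P Q (Finset.filter_subset _ _)
    (fun e he e' hf' => (hPm e').2 (prismCells_down ((hPm e).1 he) hf'))
    (fun e he e' hf' => by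
      rw [hQm] at he ⊢
      refine ⟨prismCells_down he.1 hf', he.2.imp (fun hg x hx => hg x (hf'.carrier_subset hx)) ?_⟩
      rintro ⟨h1, h2⟩
      have h3 := hf' none
      have h4 := le_upper e' none
      have h5 : none ∉ e'.2 := fun h => h1 (hf'.dirs_subset h)
      simp only [upper, h1, h5, if_false] at h3 h4
      exact ⟨h5, by omega⟩)
    Y
    (fun e he heQ e' he' heQ' hf' => by
      rw [hPm] at he he'
      have hcq := hcceq e he (hQn e he heQ) e' he' (hQn e' he' heQ') hf'
      simp only [Y, hcq]
      by_cases h1 : none ∉ e.2 ∧ e.1 none = 1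
      · have h2 : none ∉ e'.2 ∧ e'.1 none = 1 := by
          have h3 := hf' none
          have h5 : none ∉ e'.2 := fun h => h1.1 (hf'.dirs_subset h)
          simp only [upper, h1.1, h5, if_false] at h3
          exact ⟨h5, by omega⟩
        rw [if_pos h1, if_pos h2]
      · rw [if_neg h1]
        split_ifs
        · exact bdStar_faces_subset _ _
        · exact subset_rfl)
    (fun e he heQ => by
      rw [hPm] at he
      have hcore := hC _ (hccC e he (hQn e he heQ))
      simp only [Y]
      split_ifs with h1
      · refine (hc _ hcore).mono ?_
        have := card_dirs_lt_of_none he h1.1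
        omega
      · exact Conn.star hcore.1 _)
    (fun x => f₁ (prismProj M x))
    (fun e he heQ e' he' hf' => by
      rw [hPm] at he
      rw [hQm] at he'
      have hg := hQn e he heQ
      refine (hRf₁ e' he'.1).of_mem fun x hx => ?_
      have h3 := hstar e he hg x (hf'.carrier_subset hx)
      simp only [Y]
      split_ifs with h1
      · refine mem_bdStar_points (hC _ (hccC e he hg)) h3 ?_
        rcases he'.2 with h | h
        · exact hgoodL e' he'.1 h x hx
        · have := hf' none
          omega
      · exact h3)
  -- conclusion
  have hYK : ∀ e, (Y e).faces ⊆ K.faces := by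
    intro e
    simp only [Y]
    split_ifs
    · exact (bdStar_faces_subset _ _).trans (star_faces_subset _ _)
    · exact star_faces_subset _ _
  have hh'K : ∀ e ∈ P, K.IsRMap e.carrier h' := by
    intro e he
    by_cases heQ : e ∈ Q
    · exact (hRf₁ e ((hPm e).1 he)).congr (hh'Q e heQ)
    · exact (hh' e he heQ).le (hYK e)
  have hall := IsRMap.biUnion P _ hh'K fun e _ => isClosed_carrier e
  let φ : (ι → ℝ) × ℝ → Option ι → ℝ := fun p i => i.elim p.2 fun i => M * p.1 i
  have hφc : Continuous φ := by
    refine continuous_pi fun i => ?_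
    rcases i with _ | i
    · exact continuous_snd
    · simp only [φ, Option.elim]
      fun_prop
  have hφp : ∀ p, prismProj M (φ p) = p.1 := by
    intro p
    ext i
    have : (M : ℝ) ≠ 0 := by exact_mod_cast hM0.ne'
    simp only [prismProj, φ, Option.elim]
    field_simp
  have hH : K.IsRMap (Metric.sphere 0 1 ×ˢ Set.Icc (0 : ℝ) 1) fun p => h' (φ p) := by
    refine hall.comp hφc.continuousOn ?_
    rintro ⟨y, t⟩ ⟨hy, ht⟩
    obtain ⟨e, he, hxe, -⟩ := exists_prismCell (N := M) hy ht
    simp only [Set.mem_iUnion]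
    exact ⟨e, (hPm e).2 he, hxe⟩
  have hH0 : ∀ y ∈ Metric.sphere (0 : ι → ℝ) 1, h' (φ (y, 0)) = f₁ y := by
    intro y hy
    obtain ⟨e, he, hxe, -, h0⟩ := exists_prismCell (N := M) hy (t := 0) (by simp)
    have := hh'Q e ((hQm e).2 ⟨he, Or.inr (h0 rfl)⟩) hxe
    exact this.trans (by simp only; rw [hφp (y, 0)])
  have hH1 : L.IsRMap (Metric.sphere 0 1) fun y : ι → ℝ => h' (φ (y, 1)) := by
    refine (hH.comp (φ := fun y : ι → ℝ => (y, (1 : ℝ))) (by fun_prop) ?_).of_mem ?_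
    · intro y hy
      exact ⟨hy, by simp⟩
    · intro y hy
      obtain ⟨e, he, hxe, h1, -⟩ := exists_prismCell (N := M) hy (t := 1) (by simp)
      have h1 := h1 rfl
      by_cases heQ : e ∈ Q
      · have h2 : h' (φ (y, 1)) = _ := hh'Q e heQ hxe
        rw [h2]
        refine hgoodL e he ?_ _ hxe
        rcases ((hQm e).1 heQ).2 with h | h
        · exact h
        · omega
      · have h2 := (hh' e ((hPm e).2 he) heQ).mem _ hxe
        simp only [Y, if_pos h1] at h2
        exact points_mono (bdStar_faces_subset_of_core hu (hC _ (hccC e he (hQn e he heQ)))) h2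
  obtain ⟨g, hg, hgE⟩ := hL ι hι _ hH1
  obtain ⟨g₁, hg₁, hgE₁⟩ := IsRMap.extend_of_homotopy hH hH0 (hg.le hLK) fun y hy => (hgE hy).symm
  refine IsRMap.extend_of_homotopy (hf.segment hf₁ ?_) (fun y _ => by simp) hg₁
    fun y hy => by simp [hgE₁ hy]
  intro y hy
  obtain ⟨s, hs, h1, h2, h3, -⟩ := hsupp y hy
  exact ⟨s, hs, h2, (push_spec hC hu (hf.mem y hy) hs h2 h3).2.1⟩

end PreAbstractSimplicialComplex

/-! ### Gluing in terms of links, and retractions. -/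

namespace PreAbstractSimplicialComplex

variable {V : Type*}

/-- If the link of a simplex `c` is `(k - |c|)`-connected, then the boundary of its star is
`(k - 1)`-connected. -/
theorem Conn.bdStar {K : PreAbstractSimplicialComplex V} {c : Finset V} (hc : c ∈ K.faces) {k : ℤ}
    (hlk : (K.link c).Conn (k - c.card)) : (K.bdStar c).Conn (k - 1) := by
  classical
  induction hn : c.card generalizing K c k with
  | zero => exact absurd (Finset.card_eq_zero.1 hn) (K.isRelLowerSet_faces hc).1.ne_empty
  | succ n ih =>
  obtain ⟨v, hv⟩ := (K.isRelLowerSet_faces hc).1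
  set d := c.erase v with hd
  have hdc : insert v d = c := Finset.insert_erase hv
  have hvd : v ∉ d := Finset.notMem_erase v c
  have hdn : d.card = n := by rw [hd, Finset.card_erase_of_mem hv, hn]; rfl
  have hdsub : d ⊆ c := Finset.erase_subset v c
  -- Removing one vertex `v` from `c` reduces to the smaller core `d` of `K.bdStar c` without
  -- changing the link. Since `|d| = |c| - 1`, the hypothesis for `d` with `k - 1` is the one given
  -- for `c` with `k`.
  have hlink : ((K.bdStar c).link d) = K.link c := by
    ext τ
    have h1 : τ ∪ d ∪ c = τ ∪ c := by
      rw [Finset.union_assoc, Finset.union_eq_right.2 hdsub]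
    constructor
    · rintro ⟨hne, hdis, -, hK, hcs⟩
      refine ⟨hne, ?_, by convert hK using 1; convert h1.symm⟩
      rw [← hdc, Finset.disjoint_insert_right]
      refine ⟨fun hvτ => hcs ?_, hdis⟩
      rw [← hdc]
      exact Finset.insert_subset (by simp [hvτ]) (Finset.subset_union_right)
    · rintro ⟨hne, hdis, hK⟩
      refine ⟨hne, Finset.disjoint_of_subset_right hdsub hdis, ?_, ?_, fun h => ?_⟩
      · exact hne.mono Finset.subset_union_left
      · rwa [h1]
      · have := h hv
        rw [Finset.mem_union] at this
        exact this.elim (fun h => Finset.disjoint_left.1 hdis h hv) hvd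
  rcases d.eq_empty_or_nonempty with hd0 | hdne
  · have hcv : c = {v} := by rw [← hdc, hd0]; rfl
    have : K.bdStar c = K.link c := by
      ext τ
      constructor
      · rintro ⟨hne, hK, hcs⟩
        refine ⟨hne, ?_, hK⟩
        rw [hcv, Finset.singleton_subset_iff] at hcs
        rw [hcv, Finset.disjoint_singleton_right]
        exact hcs
      · rintro ⟨hne, hdis, hK⟩
        refine ⟨hne, hK, ?_⟩
        rw [hcv, Finset.disjoint_singleton_right] at hdis
        rw [hcv, Finset.singleton_subset_iff]
        exact hdis
    rw [this]
    refine hlk.mono ?_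
    rw [hcv]
    simp
  -- The simplices of the boundary of the star that do not contain `d` form a cone with apex `v`,
  -- and `d` is the only core relative to them.
  · let L : PreAbstractSimplicialComplex V :=
      { faces := {s | s ∈ (K.bdStar c).faces ∧ ¬d ⊆ s}
        isRelLowerSet_faces := fun s hs => ⟨hs.1.1, fun t hts ht =>
          ⟨((K.bdStar c).isRelLowerSet_faces hs.1).2 hts ht, fun h => hs.2 (h.trans hts)⟩⟩ }
    have hdK : d ∈ (K.bdStar c).faces := by
      refine ⟨hdne, ?_, fun h => hvd (h hv)⟩
      rwa [Finset.union_eq_right.2 hdsub]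
    have hcore : ∀ e, IsCore (K.bdStar c) L e → e = d := by
      rintro e ⟨h1, h2, h3⟩
      have hde : d ⊆ e := by
        by_contra h
        exact h2 ⟨h1, h⟩
      exact (h3 d hde hdK fun h => h.2 subset_rfl).symm
    refine Conn.glue_bdStar (L := L) (fun s hs => hs.1) ?_ ?_ ?_
    · intro s _ e e' he he' _ _
      rw [hcore e he, hcore e' he']
    · have hcd : ∀ s : Finset V, ¬d ⊆ s → ¬c ⊆ s := fun s h h' => h (hdsub.trans h')
      have hds : ¬d ⊆ {v} := by
        intro h
        obtain ⟨w, hw⟩ := hdne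
        have := Finset.mem_singleton.1 (h hw)
        exact hvd (this ▸ hw)
      have hvL : {v} ∈ L.faces := by
        refine ⟨⟨by simp, ?_, hcd _ hds⟩, hds⟩
        rwa [Finset.union_eq_right.2 (by simpa using hv)]
      refine Conn.of_cone hvL ?_ _
      rintro s ⟨⟨hne, hK, -⟩, hs⟩
      have hds : ¬d ⊆ insert v s := by
        rwa [Finset.subset_insert_iff_of_notMem hvd]
      refine ⟨⟨by simp, ?_, hcd _ hds⟩, hds⟩
      rwa [Finset.insert_union, Finset.insert_eq_of_mem (Finset.mem_union_right _ hv)]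
    · intro e he
      rw [hcore e he]
      refine ih hdK ?_ hdn
      rw [hlink]
      refine hlk.mono ?_
      rw [hdn, hn]
      push_cast
      omega

/-- The gluing theorem in terms of links: `K` is obtained from a `k`-connected complex `L` by
attaching the stars of the cores, and the link of a core `c` is `(k - |c|)`-connected. -/
theorem Conn.glue {K L : PreAbstractSimplicialComplex V} (hLK : L.faces ⊆ K.faces)
    (hu : ∀ s ∈ K.faces, ∀ c c', IsCore K L c → IsCore K L c' → c ⊆ s → c' ⊆ s → c = c')
    {k : ℤ} (hL : L.Conn k) (hc : ∀ c, IsCore K L c → (K.link c).Conn (k - c.card)) : K.Conn k :=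
  Conn.glue_bdStar hLK hu hL fun c hcore => Conn.bdStar hcore.1 (hc c hcore)

lemma mem_link_iff [DecidableEq V] {K : PreAbstractSimplicialComplex V} {σ τ : Finset V} :
    τ ∈ (K.link σ).faces ↔ τ.Nonempty ∧ Disjoint τ σ ∧ τ ∪ σ ∈ K.faces := by
  obtain rfl : ‹DecidableEq V› = fun a b => Classical.propDecidable (a = b) :=
    Subsingleton.elim _ _
  exact Iff.rfl

/-- If every simplex `τ` of `K` outside `L` is maximal and its boundary is the base of a cone in `L`,
then `L` is a retract of `K`, hence as highly connected as `K`. -/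
theorem Conn.of_retract [DecidableEq V] {K L : PreAbstractSimplicialComplex V} (hLK : L.faces ⊆ K.faces)
    (hmax : ∀ τ ∈ K.faces, τ ∉ L.faces → ∀ s ∈ K.faces, τ ⊆ s → s = τ)
    (hz : ∀ τ ∈ K.faces, τ ∉ L.faces → ∃ z, ∀ v ∈ τ, insert z (τ.erase v) ∈ L.faces)
    {k : ℤ} (hK : K.Conn k) : L.Conn k := by
  classical
  -- If `K ≠ L` there is a vertex, which serves as default value for the choice of the cone points
  -- `z`.
  by_cases hKL : K = L
  · exact hKL ▸ hK
  obtain ⟨s, hsK, -⟩ := Set.not_subset.1 fun h =>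
    hKL (PreAbstractSimplicialComplex.ext (Set.Subset.antisymm h hLK))
  have : Nonempty V := ⟨(K.isRelLowerSet_faces hsK).1.choose⟩
  choose! z hz using hz
  intro ι _ hι f hf
  obtain ⟨F, hF, hFf⟩ := hK ι hι f (hf.le hLK)
  obtain ⟨E, hE⟩ := hF.finite
  let C : Finset (Finset V) := E.powerset.filter fun τ => τ ∈ K.faces ∧ τ ∉ L.faces
  -- The retraction takes the smallest coordinate on `τ` away from every vertex of `τ` and gives the
  -- total to `z τ`. Some vertex of `τ` then has coordinate zero before any gift to `z τ`, so the
  -- point lands in a simplex `insert z (τ.erase v)`. Points of `L` do not move.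
  let r : (V → ℝ) → V → ℝ := fun x v => x v + ∑ τ ∈ C, minCoord τ x *
    ((if v = z τ then (τ.card : ℝ) else 0) - if v ∈ τ then 1 else 0)
  have hrc : Continuous r := by
    refine continuous_pi fun v => (continuous_apply v).add (continuous_finsetSum _ fun τ _ => ?_)
    exact (continuous_minCoord τ).mul continuous_const
  have hCm : ∀ τ, τ ∈ C ↔ τ ⊆ E ∧ τ ∈ K.faces ∧ τ ∉ L.faces := by simp [C]
  have hrL : ∀ x ∈ K.points, ∀ s ∈ L.faces, (∀ v ∉ s, x v = 0) → r x = x := by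
    intro x hx s hs h0
    ext v
    refine add_eq_left.2 (Finset.sum_eq_zero fun τ hτ => ?_)
    rw [hCm] at hτ
    rw [minCoord_eq_zero (points_nonneg hx) h0, zero_mul]
    intro h
    have := hmax τ hτ.2.1 hτ.2.2 s (hLK hs) h
    exact hτ.2.2 (this ▸ hs)
  have hrB : ∀ x ∈ K.points, ∀ s ∈ C, (∀ v ∉ s, x v = 0) → r x ∈ L.points := by
    intro x hx s hs h0
    have hsC := (hCm s).1 hs
    have hr : ∀ v, r x v = x v + minCoord s x *
        ((if v = z s then (s.card : ℝ) else 0) - if v ∈ s then 1 else 0) := by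
      intro v
      refine congrArg (x v + ·) (Finset.sum_eq_single_of_mem s hs fun τ hτ hne => ?_)
      rw [hCm] at hτ
      rw [minCoord_eq_zero (points_nonneg hx) h0, zero_mul]
      intro h
      exact hne (hmax τ hτ.2.1 hτ.2.2 s hsC.2.1 h).symm
    have hsne := (K.isRelLowerSet_faces hsC.2.1).1
    obtain ⟨v₀, hv₀, hmin⟩ := exists_minCoord_eq hsne x
    have ht := hz s hsC.2.1 hsC.2.2 v₀ hv₀
    set t := insert (z s) (s.erase v₀)
    have htm : ∀ w, w ∈ t ↔ w = z s ∨ w ∈ s ∧ w ≠ v₀ := fun w => by simp [t, and_comm]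
    have hzero : ∀ v ∉ t, r x v = 0 := by
      intro v hv
      rw [htm] at hv
      push Not at hv
      rw [hr, if_neg hv.1]
      by_cases hvs : v ∈ s
      · rw [if_pos hvs, hv.2 hvs, hmin]
        ring
      · rw [if_neg hvs, h0 v hvs]
        ring
    refine ⟨t, ht, fun v => ?_, hzero, ?_⟩
    · rw [hr]
      have h1 := minCoord_nonneg (c := s) (points_nonneg hx)
      have h2 := points_nonneg hx v
      have h3 : (0 : ℝ) ≤ if v = z s then (s.card : ℝ) else 0 := by split_ifs <;> positivity
      by_cases hvs : v ∈ s
      · rw [if_pos hvs]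
        have h4 := minCoord_le hvs x
        nlinarith
      · rw [if_neg hvs, sub_zero]
        positivity
    · have hts : t ⊆ insert (z s) s := fun w hw => by
        rw [Finset.mem_insert]
        exact ((htm w).1 hw).imp id And.left
      rw [Finset.sum_subset hts fun v _ hv => hzero v hv]
      simp_rw [hr]
      rw [Finset.sum_add_distrib, ← Finset.mul_sum, Finset.sum_sub_distrib,
        sum_eq_one_of_mem_points hx fun v hv => h0 v fun h => hv (Finset.mem_insert_of_mem h),
        Finset.sum_ite_eq' (insert (z s) s) (z s), if_pos (Finset.mem_insert_self _ _),
        Finset.sum_ite_mem, Finset.inter_eq_right.2 (Finset.subset_insert _ _)]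
      simp
  refine ⟨fun y => r (F y), ⟨⟨E ∪ C.image z, fun y hy v hv => ?_⟩, hrc.comp_continuousOn hF.cont,
    fun y hy => ?_⟩, fun y hy => ?_⟩
  · simp only [Finset.mem_union, Finset.mem_image, not_or, not_exists, not_and] at hv
    have : ∑ τ ∈ C, minCoord τ (F y) *
        ((if v = z τ then (τ.card : ℝ) else 0) - if v ∈ τ then 1 else 0) = 0 := by
      refine Finset.sum_eq_zero fun τ hτ => ?_
      rw [if_neg fun h => hv.2 τ hτ h.symm, if_neg fun h => hv.1 (((hCm τ).1 hτ).1 h)]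
      ring
    simp only [r, this, hE y hy v hv.1, add_zero]
  · obtain ⟨s, hs, h1, h2, h3⟩ := exists_support (hF.mem y hy)
    by_cases hsL : s ∈ L.faces
    · rw [hrL _ (hF.mem y hy) s hsL h2]
      exact ⟨s, hsL, points_nonneg (hF.mem y hy), h2, h3⟩
    · refine hrB _ (hF.mem y hy) s ((hCm s).2 ⟨fun v hv => ?_, hs, hsL⟩) h2
      by_contra h
      exact (h1 v hv).ne' (hE y hy v h)
  · obtain ⟨s, hs, -, h2, -⟩ := exists_support (hf.mem y hy)
    have hyK := points_mono hLK (hf.mem y hy)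
    change r (F y) = f y
    rw [hFf hy, hrL _ hyK s hs h2]

end PreAbstractSimplicialComplex

/-! ### Homotopy groups of the realization with the weak topology. -/

namespace PreAbstractSimplicialComplex

variable {V : Type*} {K : PreAbstractSimplicialComplex V}

/-- A set-level point of the realization, as a point of the realization. -/
def toRealization {x : V → ℝ} (hx : x ∈ K.points) : K.Realization := ⟨x, hx⟩

/-- On each closed simplex the sum is finite and linear, so the weak topology allows arbitrary, even
unbounded, weights. That freedom is what forces compact families into finite subcomplexes. -/
lemma continuous_weightedSum (w : V → ℝ) :
    Continuous fun x : K.Realization => ∑ᶠ v, w v * x.1 v := by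
  classical
  refine continuous_iSup_dom.2 fun s => continuous_coinduced_dom.2 ?_
  have : (fun x : K.Realization => ∑ᶠ v, w v * x.1 v) ∘ K.faceMap s =
      fun x => ∑ v : (s : Finset V), w v * x.1 v := by
    ext x
    simp only [Function.comp]
    rw [finsum_eq_sum_of_support_subset (s := (s : Finset V)), ← Finset.sum_coe_sort]
    · refine Finset.sum_congr rfl fun v _ => ?_
      simp [faceMap]
    · intro v hv
      by_contra h
      exact hv (by simp [faceMap, show v ∉ (s : Finset V) from h])
  rw [this]
  refine continuous_finsetSum _ fun v _ => continuous_const.mul ?_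
  exact (continuous_apply v).comp continuous_subtype_val

lemma continuous_coord (v : V) : Continuous fun x : K.Realization => x.1 v := by
  classical
  convert continuous_weightedSum (K := K) (Pi.single v 1) using 2 with x
  rw [finsum_eq_single _ v fun w hw => by simp [hw]]
  simp

/-- A compact family of points of the realization lies in a finite subcomplex. -/
lemma exists_finite_support {Z : Type*} [TopologicalSpace Z] [CompactSpace Z]
    {f : Z → K.Realization} (hf : Continuous f) :
    ∃ E : Finset V, ∀ z, ∀ v ∉ E, (f z).1 v = 0 := by
  classical
  by_cases hfin : {v | ∃ z, (f z).1 v ≠ 0}.Finite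
  · refine ⟨hfin.toFinset, fun z v hv => ?_⟩
    by_contra h
    exact hv (hfin.mem_toFinset.2 ⟨z, h⟩)
  exfalso
  let u := Set.Infinite.natEmbedding _ hfin
  choose z hz using fun n => (u n).2
  have hpos : ∀ n, 0 < (f (z n)).1 (u n) := fun n =>
    lt_of_le_of_ne (points_nonneg (f (z n)).2 _) (hz n).symm
  -- With these weights the sum at `f (z n)` is at least `n`, which is impossible for a continuous
  -- function on a compact space.
  let w : V → ℝ := fun v => if h : ∃ n, (u n : V) = v then h.choose / (f (z h.choose)).1 v else 0
  have hw : ∀ n, w (u n) = n / (f (z n)).1 (u n) := by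
    intro n
    have h : ∃ m, (u m : V) = u n := ⟨n, rfl⟩
    have h' : h.choose = n := u.injective (Subtype.ext h.choose_spec)
    simp only [w, dif_pos h, h']
  have hw0 : ∀ v, 0 ≤ w v := by
    intro v
    simp only [w]
    split_ifs with h
    · exact div_nonneg (Nat.cast_nonneg _) (points_nonneg (f _).2 _)
    · exact le_rfl
  obtain ⟨B, hB⟩ := (isCompact_range ((continuous_weightedSum w).comp hf)).bddAbove
  obtain ⟨n, hn⟩ := exists_nat_gt B
  have h1 := hB ⟨z n, rfl⟩
  obtain ⟨s, hs, h2, h3, -⟩ := exists_support (f (z n)).2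
  have h4 : w (u n) * (f (z n)).1 (u n) ≤ ∑ᶠ v, w v * (f (z n)).1 v := by
    refine single_le_finsum _ (s.finite_toSet.subset fun v hv => ?_) fun v =>
      mul_nonneg (hw0 v) (points_nonneg (f (z n)).2 v)
    by_contra h
    exact hv (by simp [h3 v h])
  rw [hw, div_mul_cancel₀ _ (hpos n).ne'] at h4
  simp only [Function.comp] at h1
  linarith

/-- Maps into a finite subcomplex that are continuous in barycentric coordinates are continuous for
the weak topology. -/
lemma IsRMap.continuous {Z : Type*} [TopologicalSpace Z] {g : Z → V → ℝ}
    (hg : K.IsRMap Set.univ g) :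
    Continuous fun z => toRealization (hg.mem z trivial) := by
  classical
  obtain ⟨E, hE⟩ := hg.finite
  have hgc : Continuous g := continuousOn_univ.1 hg.cont
  have hgv : ∀ v, Continuous fun z => g z v := fun v => (continuous_apply v).comp hgc
  rw [continuous_iff_isClosed]
  intro C hC
  have hC' : ∀ s, IsClosed (K.faceMap s ⁻¹' C) := fun s =>
    isClosed_coinduced.1 ((isClosed_iSup_iff (t := fun s : K.faces =>
      TopologicalSpace.coinduced (K.faceMap s) inferInstance)).1 hC s)
  -- On the closed set where the support lies in `s`, the map factors continuously through the
  -- closed simplex `s`. The preimage of `C` is the union of these pieces over the finitely many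
  -- faces inside `E`.
  have key : ∀ s : K.faces, IsClosed {z | (∀ v ∉ (s : Finset V), g z v = 0) ∧
      toRealization (hg.mem z trivial) ∈ C} := by
    intro s
    let Zs : Set Z := {z | ∀ v ∉ (s : Finset V), g z v = 0}
    have hZs : IsClosed Zs := by
      have : Zs = ⋂ v, ⋂ (_ : v ∉ (s : Finset V)), {z | g z v = 0} := by
        ext z
        simp [Zs]
      rw [this]
      exact isClosed_iInter fun v => isClosed_iInter fun _ => isClosed_eq (hgv v) continuous_const
    let h : Zs → stdSimplex ℝ (s : Finset V) := fun z => ⟨fun v => g z v,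
      fun v => points_nonneg (hg.mem z trivial) v, by
        rw [Finset.sum_coe_sort (s : Finset V) (fun v => g z v)]
        exact sum_eq_one_of_mem_points (hg.mem z trivial) z.2⟩
    have hh : Continuous h :=
      continuous_induced_rng.2 (continuous_pi fun v => (hgv v).comp continuous_subtype_val)
    convert hZs.isClosedEmbedding_subtypeVal.isClosedMap _ ((hC' s).preimage hh) using 1
    have hval : ∀ z : Zs, K.faceMap s (h z) = toRealization (hg.mem z trivial) := by
      intro z
      refine Subtype.ext (funext fun v => ?_)
      by_cases hv : v ∈ (s : Finset V)
      · simp [faceMap, toRealization, h, hv]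
      · simp [faceMap, toRealization, hv, z.2 v hv]
    ext z
    simp only [Set.mem_image, Set.mem_preimage, Subtype.exists]
    constructor
    · rintro ⟨h1, h2⟩
      exact ⟨z, h1, by rwa [hval ⟨z, h1⟩], rfl⟩
    · rintro ⟨z, h1, h2, rfl⟩
      rw [hval ⟨z, h1⟩] at h2
      exact ⟨h1, h2⟩
  have hfin : {s : K.faces | (s : Finset V) ⊆ E}.Finite :=
    (Finset.finite_toSet E.powerset |>.subset fun s (hs : s ⊆ E) => Finset.mem_coe.2
      (Finset.mem_powerset.2 hs)).preimage Subtype.val_injective.injOn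
  convert hfin.isClosed_biUnion fun s _ => key s using 1
  ext z
  simp only [Set.mem_preimage, Set.mem_iUnion, exists_prop]
  constructor
  · intro hz
    obtain ⟨s, hs, h1, h2, -⟩ := exists_support (hg.mem z trivial)
    refine ⟨⟨s, hs⟩, fun v hv => ?_, h2, hz⟩
    by_contra h
    exact (h1 v hv).ne' (hE z trivial v h)
  · rintro ⟨s, -, -, hz⟩
    exact hz

lemma isRMap_of_continuous {Z : Type*} [TopologicalSpace Z] [CompactSpace Z]
    {f : Z → K.Realization} (hf : Continuous f) : K.IsRMap Set.univ fun z => (f z).1 := by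
  obtain ⟨E, hE⟩ := exists_finite_support hf
  exact ⟨⟨E, fun z _ => hE z⟩,
    (continuous_pi fun v => (continuous_coord v).comp hf).continuousOn, fun z _ => (f z).2⟩

open unitInterval in
/-- The affine map from `[-1, 1]` to the unit interval. -/
noncomputable def toUnitInterval (y : ℝ) : I := Set.projIcc 0 1 zero_le_one ((y + 1) / 2)

lemma continuous_toUnitInterval : Continuous toUnitInterval :=
  continuous_projIcc.comp (by fun_prop)

open unitInterval in
lemma toUnitInterval_apply (t : I) : toUnitInterval (2 * t - 1) = t := by
  unfold toUnitInterval
  rw [show ((2 * (t : ℝ) - 1 + 1) / 2) = t by ring]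
  exact Set.projIcc_val _ t

-- A homotopy relative to the boundary is a filling of an `(i + 1)`-cube whose boundary carries `p`
-- and `q` on two opposite faces and the base point on all others. After rescaling, this boundary is
-- the supremum-norm sphere in `Option (Fin i) → ℝ`, of dimension `i`.
open unitInterval in
lemma genLoop_homotopic {i : ℕ} (hK : K.Conn i) {x : K.Realization}
    (p q : GenLoop (Fin i) K.Realization x) : GenLoop.Homotopic p q := by
  classical
  let φ : (Option (Fin i) → ℝ) → Fin i → I := fun y j => toUnitInterval (y (some j))
  have hφ : Continuous φ := continuous_pi fun j =>
    continuous_toUnitInterval.comp (continuous_apply _)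
  have hφb : ∀ y : Option (Fin i) → ℝ, ∀ j : Fin i, |y (some j)| = 1 →
      φ y ∈ Cube.boundary (Fin i) := by
    intro y j hy
    refine ⟨j, ?_⟩
    rcases (abs_eq zero_le_one).1 hy with h | h
    · right
      have := toUnitInterval_apply 1
      simp only [φ, h]
      convert this using 2
      norm_num
    · left
      have := toUnitInterval_apply 0
      simp only [φ, h]
      convert this using 2
      norm_num
  let g : (Option (Fin i) → ℝ) → V → ℝ := fun y =>
    if y none = -1 then (p (φ y)).1 else if y none = 1 then (q (φ y)).1 else x.1
  have gp : ∀ y : Option (Fin i) → ℝ, y none = -1 → g y = (p (φ y)).1 := fun y hy => if_pos hy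
  have gq : ∀ y : Option (Fin i) → ℝ, y none = 1 → g y = (q (φ y)).1 := fun y hy => by
    simp only [g]
    rw [if_neg (by rw [hy]; norm_num), if_pos hy]
  have gx : ∀ y : Option (Fin i) → ℝ, ∀ j, |y (some j)| = 1 → g y = x.1 := fun y j hj => by
    have hp : (p (φ y)).1 = x.1 := congrArg Subtype.val (p.2 _ (hφb y j hj))
    have hq : (q (φ y)).1 = x.1 := congrArg Subtype.val (q.2 _ (hφb y j hj))
    simp only [g]
    split_ifs
    exacts [hp, hq, rfl]
  have hA : K.IsRMap {y : Option (Fin i) → ℝ | y none = -1} g :=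
    ((isRMap_of_continuous p.1.continuous).comp hφ.continuousOn fun _ _ => trivial).congr
      fun y hy => gp y hy
  have hB : K.IsRMap {y : Option (Fin i) → ℝ | y none = 1} g :=
    ((isRMap_of_continuous q.1.continuous).comp hφ.continuousOn fun _ _ => trivial).congr
      fun y hy => gq y hy
  have hx : ∀ S : Set (Option (Fin i) → ℝ), K.IsRMap S fun _ => x.1 := fun S => by
    obtain ⟨s, hs, -, h2, -⟩ := exists_support x.2
    exact ⟨⟨s, fun _ _ => h2⟩, continuousOn_const, fun _ _ => x.2⟩
  have hC : ∀ j ∈ (Finset.univ : Finset (Fin i)),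
      K.IsRMap {y : Option (Fin i) → ℝ | |y (some j)| = 1} g :=
    fun j _ => (hx _).congr fun y hy => gx y j hy
  have cA : IsClosed {y : Option (Fin i) → ℝ | y none = -1} :=
    isClosed_eq (continuous_apply _) continuous_const
  have cB : IsClosed {y : Option (Fin i) → ℝ | y none = 1} :=
    isClosed_eq (continuous_apply _) continuous_const
  have cC : ∀ j ∈ (Finset.univ : Finset (Fin i)),
      IsClosed {y : Option (Fin i) → ℝ | |y (some j)| = 1} :=
    fun j _ => isClosed_eq (continuous_apply _).abs continuous_const
  have hg := ((hA.union hB cA cB).union (IsRMap.biUnion _ _ hC cC) (cA.union cB)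
    (Finset.univ.finite_toSet.isClosed_biUnion fun j _ => cC j (Finset.mem_univ j))).mono
      (T := Metric.sphere 0 1) (by
    intro y hy
    rw [mem_sphere_pi] at hy
    obtain ⟨-, j, hj⟩ := hy
    rcases j with _ | j
    · rcases (abs_eq zero_le_one).1 hj with h | h
      · exact Or.inl (Or.inr h)
      · exact Or.inl (Or.inl h)
    · refine Or.inr ?_
      simp only [Set.mem_iUnion]
      exact ⟨j, Finset.mem_univ j, hj⟩)
  obtain ⟨G, hG, hGg⟩ := hK (Option (Fin i)) (by simp) g hg
  let ψ : I × (Fin i → I) → Option (Fin i) → ℝ := fun z j =>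
    2 * (j.elim (z.1 : ℝ) fun j => (z.2 j : ℝ)) - 1
  have hψ : Continuous ψ := by
    refine continuous_pi fun j => ?_
    rcases j with _ | j
    · simp only [ψ, Option.elim]
      fun_prop
    · simp only [ψ, Option.elim]
      fun_prop
  have hψb : ∀ z, ψ z ∈ Metric.closedBall (0 : Option (Fin i) → ℝ) 1 := by
    have h : ∀ t : I, |2 * (t : ℝ) - 1| ≤ 1 := fun t => by
      rw [abs_le]
      constructor <;> linarith [t.2.1, t.2.2]
    intro z
    rw [mem_closedBall_pi]
    rintro (_ | j)
    · exact h z.1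
    · exact h (z.2 j)
  have hφψ : ∀ z, φ (ψ z) = z.2 := fun z => funext fun j => toUnitInterval_apply (z.2 j)
  have hF : K.IsRMap Set.univ fun z => G (ψ z) :=
    hG.comp hψ.continuousOn fun z _ => hψb z
  have hend : ∀ z, ∀ j, |ψ z j| = 1 → G (ψ z) = g (ψ z) := fun z j hj =>
    hGg (mem_sphere_pi.2 ⟨mem_closedBall_pi.1 (hψb z), j, hj⟩)
  let F : C(I × (Fin i → I), K.Realization) :=
    ⟨fun z => toRealization (hF.mem z trivial), hF.continuous⟩
  refine ⟨⟨⟨F, fun u => ?_, fun u => ?_⟩, fun t u hu => ?_⟩⟩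
  · have h1 : ψ (0, u) none = -1 := by simp [ψ]
    refine Subtype.ext ?_
    change G (ψ (0, u)) = _
    rw [hend (0, u) none (by rw [h1]; simp), gp _ h1, hφψ]
    rfl
  · have h1 : ψ (1, u) none = 1 := by simp only [ψ, Option.elim]; norm_num
    refine Subtype.ext ?_
    change G (ψ (1, u)) = _
    rw [hend (1, u) none (by rw [h1]; simp), gq _ h1, hφψ]
    rfl
  · obtain ⟨j, hj⟩ := hu
    have h1 : |ψ (t, u) (some j)| = 1 := by
      rcases hj with h | h
      · simp [ψ, h]
      · simp only [ψ, h, Option.elim]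
        norm_num
    refine Subtype.ext ?_
    change G (ψ (t, u)) = (p.1 u).1
    rw [hend (t, u) (some j) h1, gx _ j h1, p.2 u ⟨j, hj⟩]

/-- Combinatorial `k`-connectedness implies `k`-connectedness of the geometric realization. -/
theorem Conn.isHighlyConnected {k : ℤ} (hK : K.Conn k) : IsHighlyConnected k K.Realization := by
  refine ⟨fun hk => ?_, fun i hi x => ?_⟩
  -- Over the empty index type the sphere is empty and the ball is a point, so the extension
  -- property yields a point of the realization.
  · obtain ⟨G, hG, -⟩ := hK Empty (by simpa using by omega) (fun _ _ => 0)
      ⟨⟨∅, by simp⟩, continuousOn_const, fun y hy => by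
        obtain ⟨-, j, -⟩ := mem_sphere_pi.1 hy
        exact j.elim⟩
    exact ⟨toRealization (hG.mem 0 (by simp))⟩
  · refine ⟨fun a b => ?_⟩
    induction a using Quotient.inductionOn with | _ p
    induction b using Quotient.inductionOn with | _ q
    exact Quotient.sound (genLoop_homotopic (hK.mono hi) p q)

end PreAbstractSimplicialComplex

/-! ### Independence complexes. -/

namespace PreAbstractSimplicialComplex

variable {F : Type*} [Field F] {T : Type*}

/-- The complex of finite sets on which the family `g` is linearly independent. -/
def indepComplex (F : Type*) [Field F] {M T : Type*} [AddCommGroup M] [Module F M] (g : T → M) :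
    PreAbstractSimplicialComplex T where
  faces := {s | s.Nonempty ∧ LinearIndepOn F g (s : Set T)}
  isRelLowerSet_faces := fun s hs => ⟨hs.1, fun t hts ht => ⟨ht, hs.2.mono (by simpa using hts)⟩⟩

/-- Being independent together with `c` means being independent modulo the span of `c`. The index
set can stay the same: indices whose vectors die in the quotient, in particular those in `c`, belong
to no simplex. -/
lemma link_indepComplex {M : Type*} [AddCommGroup M] [Module F M] (g : T → M) {c : Finset T}
    (hc : LinearIndepOn F g (c : Set T)) :
    (indepComplex F g).link c =
      indepComplex F ((Submodule.span F (g '' c)).mkQ ∘ g) := by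
  classical
  ext τ
  constructor
  · rintro ⟨hne, hdis, -, h⟩
    refine ⟨hne, ?_⟩
    rw [Finset.union_comm, Finset.coe_union] at h
    exact ((linearIndepOn_union_iff_quotient (by simpa using hdis.symm)).1 h).2
  · rintro ⟨hne, h⟩
    have hdis : Disjoint τ c := by
      rw [Finset.disjoint_left]
      intro t ht htc
      refine h.ne_zero (Finset.mem_coe.2 ht) ?_
      simp only [Function.comp, Submodule.mkQ_apply, Submodule.Quotient.mk_eq_zero]
      exact Submodule.subset_span ⟨t, htc, rfl⟩
    refine ⟨hne, hdis, hne.mono Finset.subset_union_left, ?_⟩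
    rw [Finset.union_comm, Finset.coe_union]
    exact (linearIndepOn_union_iff_quotient (by simpa using hdis.symm)).2 ⟨hc, h⟩

/-- Coordinates with respect to the independent family on `s` are unique, so the two expansions of
`x` coincide and are supported on the intersection. -/
lemma mem_span_image_inter {M : Type*} [AddCommGroup M] [Module F M] {g : T → M}
    {s c c' : Set T} (hs : LinearIndepOn F g s) (hc : c ⊆ s) (hc' : c' ⊆ s) {x : M}
    (hx : x ∈ Submodule.span F (g '' c)) (hx' : x ∈ Submodule.span F (g '' c')) :
    x ∈ Submodule.span F (g '' (c ∩ c')) := by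
  rw [Finsupp.mem_span_image_iff_linearCombination] at hx hx' ⊢
  obtain ⟨l, hl, rfl⟩ := hx
  obtain ⟨l', hl', he⟩ := hx'
  have : l' = l := linearIndepOn_iffₛ.1 hs l' (Finsupp.supported_mono hc' hl') l
    (Finsupp.supported_mono hc hl) he
  subst this
  refine ⟨l', ?_, rfl⟩
  rw [Finsupp.supported_inter]
  exact ⟨hl, hl'⟩

/-- The independence complex of a spanning family of a space of dimension `n` is
`(n - 2)`-connected. -/
theorem conn_indepComplex {M : Type*} [AddCommGroup M] [Module F M] [FiniteDimensional F M]
    (g : T → M) (hg : Submodule.span F (Set.range g) = ⊤) :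
    (indepComplex F g).Conn (Module.finrank F M - 2) := by
  classical
  induction hn : Module.finrank F M using Nat.strong_induction_on generalizing M with
  | _ n ih =>
  by_cases h0 : ∃ t₀, g t₀ ≠ 0
  swap
  · push Not at h0
    have : Module.finrank F M = 0 := by
      have h1 : Submodule.span F (Set.range g) = ⊥ := by
        rw [Submodule.span_eq_bot]
        rintro _ ⟨t, rfl⟩
        exact h0 t
      rw [← finrank_top, ← hg, h1, finrank_bot]
    intro ι _ hι
    omega
  obtain ⟨t₀, ht₀⟩ := h0
  -- This is the closed star of `t₀`, a cone.
  let L : PreAbstractSimplicialComplex T :=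
    { faces := {s | s.Nonempty ∧ LinearIndepOn F g (insert t₀ s : Finset T)}
      isRelLowerSet_faces := fun s hs => ⟨hs.1, fun t hts ht => ⟨ht, hs.2.mono (by
        simpa using Set.insert_subset_insert (by simpa using hts))⟩⟩ }
  have hcore : ∀ c, c ∈ (indepComplex F g).faces → c ∉ L.faces →
      t₀ ∉ c ∧ g t₀ ∈ Submodule.span F (g '' c) := by
    intro c hc hcL
    have h1 : ¬LinearIndepOn F g (insert t₀ c : Finset T) := fun h => hcL ⟨hc.1, h⟩
    have h2 : t₀ ∉ c := fun h => h1 (by rw [Finset.insert_eq_of_mem h]; exact hc.2)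
    refine ⟨h2, ?_⟩
    rw [Finset.coe_insert, linearIndepOn_insert (by simpa using h2)] at h1
    by_contra h
    exact h1 ⟨hc.2, h⟩
  refine Conn.glue (K := indepComplex F g) (L := L) (fun s hs => ⟨hs.1, hs.2.mono (by simp)⟩) ?_ ?_ ?_
  -- Both cores span `g t₀`, hence so does their intersection. It is nonempty because `g t₀ ≠ 0`, so
  -- by minimality it is all of `c`, and by symmetry all of `c'`.
  · have key : ∀ s ∈ (indepComplex F g).faces, ∀ c c', IsCore (indepComplex F g) L c →
        IsCore (indepComplex F g) L c' → c ⊆ s → c' ⊆ s → c ∩ c' = c := by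
      intro s hs c c' hc hc' hcs hcs'
      have h1 := hcore c hc.1 hc.2.1
      have h2 := hcore c' hc'.1 hc'.2.1
      have h3 := mem_span_image_inter hs.2 (by simpa using hcs) (by simpa using hcs') h1.2 h2.2
      have hne : (c ∩ c').Nonempty := by
        rw [Finset.nonempty_iff_ne_empty]
        intro h
        rw [← Finset.coe_inter, h] at h3
        simp [ht₀] at h3
      refine hc.2.2 _ Finset.inter_subset_left
        (((indepComplex F g).isRelLowerSet_faces hc.1).2 Finset.inter_subset_left hne) ?_
      rintro ⟨-, h⟩
      rw [Finset.coe_insert, linearIndepOn_insert (by simp [h1.1])] at h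
      exact h.2 (by simpa using h3)
    intro s hs c c' hc hc' hcs hcs'
    rw [← key s hs c c' hc hc' hcs hcs', Finset.inter_comm, key s hs c' c hc' hc hcs' hcs]
  · have hL : {t₀} ∈ L.faces := ⟨by simp, by simpa using ht₀⟩
    have hins : ∀ s ∈ L.faces, insert t₀ s ∈ L.faces := fun s hs =>
      ⟨by simp, by rw [Finset.insert_idem]; exact hs.2⟩
    exact Conn.of_cone hL hins _
  · intro c hc
    rw [link_indepComplex g hc.1.2]
    have hfr : Module.finrank F (Submodule.span F (g '' (c : Set T))) = c.card := by
      have := finrank_span_eq_card (R := F) (b := fun t : c => g t) hc.1.2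
      rw [Fintype.card_coe] at this
      rw [← this, Set.image_eq_range]
      rfl
    have hq := Submodule.finrank_quotient_add_finrank (Submodule.span F (g '' (c : Set T)))
    rw [hfr, hn] at hq
    have hcpos := hc.nonempty.card_pos
    refine (ih _ (by omega) _ ?_ rfl).mono (by omega)
    rw [Set.range_comp, Submodule.span_image, hg, Submodule.map_top, Submodule.range_mkQ]

end PreAbstractSimplicialComplex

/-! ### Partial `±`-bases of determinant `±1`. -/

namespace PMBasis

open PreAbstractSimplicialComplex

variable {F : Type*} [Field F] {n : ℕ}

/-- A representative of a `±`-vector. -/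
noncomputable def rep (a : PMVector F n) : Fin n → F := a.2.choose

lemma mem_iff (a : PMVector F n) {x : Fin n → F} : x ∈ a.1 ↔ x = rep a ∨ x = -rep a := by
  rw [a.2.choose_spec.2]
  rfl

lemma rep_mem (a : PMVector F n) : rep a ∈ a.1 := (mem_iff a).2 (Or.inl rfl)

lemma exists_unit_smul {a : PMVector F n} {x y : Fin n → F} (hx : x ∈ a.1) (hy : y ∈ a.1) :
    ∃ c : Fˣ, x = c • y := by
  rcases eq_or_eq_neg hx hy with h | h
  · exact ⟨1, by simp [h]⟩
  · exact ⟨-1, by simp [h]⟩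

/-- Over a field every independent family extends to a basis, and changing representatives
multiplies by units, which preserves independence. -/
lemma isPartialPMBasis_iff {s : Finset (PMVector F n)} :
    IsPartialPMBasis s ↔ LinearIndepOn F rep (s : Set (PMVector F n)) := by
  constructor
  · rintro ⟨v, hv, b, hb⟩
    choose f hf using fun a : s => hb ⟨a, rfl⟩
    have hinj : Function.Injective f := by
      intro a a' h
      have : v a = v a' := by rw [← hf a, ← hf a', h]
      exact Subtype.ext (eq_of_mem (hv a) (this ▸ hv a'))
    choose c hc using fun a : s => exists_unit_smul (rep_mem a.1) (hv a)
    have h1 : LinearIndependent F (b ∘ f) := b.linearIndependent.comp f hinj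
    have h2 := h1.units_smul c
    have h3 : (fun a : s => rep a.1) = c • (b ∘ f) := by
      ext1 a
      rw [hc a]
      simp [hf a]
    change LinearIndependent F fun a : s => rep a.1
    rwa [h3]
  · intro h
    have h' : LinearIndependent F fun a : s => rep a.1 := h
    refine ⟨fun a => rep a.1, fun a => rep_mem a.1, ?_⟩
    have h'' : LinearIndepOn F id (Set.range fun a : s => rep a.1) := h'.linearIndepOn_id
    let b := Module.Basis.extend h''
    let e := b.indexEquiv (Pi.basisFun F (Fin n))
    refine ⟨b.reindex e, ?_⟩
    rw [Module.Basis.range_reindex, Module.Basis.range_extend]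
    exact Module.Basis.subset_extend h''

lemma IsDetOne.linearIndepOn {s : Finset (PMVector F n)} (h : IsDetOne s) :
    LinearIndepOn F rep (s : Set (PMVector F n)) := isPartialPMBasis_iff.1 h.1

lemma card_le_of_linearIndepOn {s : Finset (PMVector F n)}
    (h : LinearIndepOn F rep (s : Set (PMVector F n))) : s.card ≤ n :=
  (isPartialPMBasis_iff.2 h).card_le

lemma isDetOne_of_card_ne {s : Finset (PMVector F n)}
    (h : LinearIndepOn F rep (s : Set (PMVector F n))) (hc : s.card ≠ n) : IsDetOne s := by
  refine ⟨isPartialPMBasis_iff.2 h, fun e => (hc ?_).elim⟩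
  simpa using (Fintype.card_congr e).symm

lemma det_of_eq (u : Fin n → Fin n → F) :
    (Matrix.of fun i j => u j i).det = Matrix.detRowAlternating u :=
  Matrix.det_transpose (Matrix.of u)

/-- Being `1` or `-1`. -/
def IsSign (x : F) : Prop := x = 1 ∨ x = -1

lemma IsSign.mul {x y : F} (hx : IsSign x) (hy : IsSign y) : IsSign (x * y) := by
  rcases hx with rfl | rfl <;> rcases hy with rfl | rfl <;> simp [IsSign]

lemma IsSign.ne_zero {x : F} (hx : IsSign x) : x ≠ 0 := by
  rcases hx with rfl | rfl <;> simp

/-- A family of `±`-vectors whose representatives have determinant `±1` is a determinant-`1` partial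
`±`-basis. -/
lemma isDetOne_of_det [DecidableEq (PMVector F n)] {s : Finset (PMVector F n)}
    {u : Fin n → PMVector F n}
    (hu : IsSign (Matrix.detRowAlternating fun j => rep (u j))) (hs : Finset.univ.image u = s) :
    Function.Injective u ∧ IsDetOne s := by
  have hli : LinearIndependent F fun j => rep (u j) :=
    ((Matrix.linearIndependent_rows_iff_isUnit (A := Matrix.of fun j => rep (u j))).2
      ((Matrix.isUnit_iff_isUnit_det _).2 (isUnit_iff_ne_zero.2 hu.ne_zero)))
  have hinj : Function.Injective u := fun i j h => hli.injective (congrArg rep h)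
  have hs' : (s : Set (PMVector F n)) = Set.range u := by rw [← hs]; simp
  refine ⟨hinj, isPartialPMBasis_iff.2 ?_, fun e v hv => ?_⟩
  · rw [hs']
    exact (linearIndepOn_range_iff hinj rep).2 hli
  · have hmem : ∀ j, ∃ i, u i = (e j).1 := fun j => by
      have : ((e j).1 : PMVector F n) ∈ (s : Set (PMVector F n)) := (e j).2
      rwa [hs'] at this
    choose p hp using hmem
    have hpinj : Function.Injective p := by
      intro i j h
      have : (e i).1 = (e j).1 := by rw [← hp i, ← hp j, h]
      exact e.injective (Subtype.ext this)
    let q : Equiv.Perm (Fin n) := Equiv.ofBijective p (Finite.injective_iff_bijective.1 hpinj)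
    have hsign : ∀ j, ∃ c : F, IsSign c ∧ v j = c • rep (u (q j)) := by
      intro j
      have h1 := hv j
      rw [← hp j, mem_iff] at h1
      rcases h1 with h | h
      · exact ⟨1, Or.inl rfl, by simpa [q] using h⟩
      · exact ⟨-1, Or.inr rfl, by simpa [q] using h⟩
    choose c hc hvc using hsign
    change IsSign _
    rw [det_of_eq, show v = fun j => c j • rep (u (q j)) from funext hvc]
    have h1 : Matrix.detRowAlternating (fun j => c j • rep (u (q j))) =
        (∏ j, c j) * Matrix.detRowAlternating (fun j => rep (u (q j))) :=
      (Matrix.detRowAlternating (R := F)).map_smul_univ c fun j => rep (u (q j))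
    have h2 : Matrix.detRowAlternating (fun j => rep (u (q j))) =
        Equiv.Perm.sign q • Matrix.detRowAlternating (fun j => rep (u j)) :=
      (Matrix.detRowAlternating (R := F)).map_perm (fun j => rep (u j)) q
    rw [h1, h2]
    refine IsSign.mul (Finset.prod_induction _ IsSign (fun _ _ => IsSign.mul) (Or.inl rfl)
      fun j _ => hc j) ?_
    rcases Int.units_eq_one_or (Equiv.Perm.sign q) with h | h
    · rw [h, one_smul]
      exact hu
    · rw [h, Units.neg_smul, one_smul, neg_eq_neg_one_mul]
      exact IsSign.mul (Or.inr rfl) hu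

lemma span_range_rep : Submodule.span F (Set.range (rep : PMVector F n → Fin n → F)) = ⊤ := by
  rw [eq_top_iff]
  intro x _
  by_cases hx : x = 0
  · rw [hx]
    exact zero_mem _
  · have h1 : x ∈ (pm x hx).1 := Or.inl rfl
    have h2 : rep (pm x hx) ∈ Submodule.span F (Set.range (rep : PMVector F n → Fin n → F)) :=
      Submodule.subset_span ⟨_, rfl⟩
    rcases (mem_iff _).1 h1 with h | h
    · rwa [h]
    · rw [h]
      exact neg_mem h2

open Classical in
/-- The link of `σ` in the complex of determinant-`1` partial `±`-bases. -/
def detLink (σ : Finset (PMVector F n)) : PreAbstractSimplicialComplex (PMVector F n) where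
  faces := {τ | τ.Nonempty ∧ Disjoint τ σ ∧ IsDetOne (τ ∪ σ)}
  isRelLowerSet_faces := fun _ hτ => ⟨hτ.1, fun _ hρ hne => ⟨hne,
    Finset.disjoint_of_subset_left hρ hτ.2.1, hτ.2.2.mono (Finset.union_subset_union_left hρ)⟩⟩

open Classical in
/-- A basis of determinant different from `±1` bounds in the complex of determinant-`1` partial
bases: it is coned off by a suitable multiple of the sum of some of its vectors. -/
lemma exists_cone_vertex {σ τ : Finset (PMVector F n)} (hne : τ.Nonempty) (hdis : Disjoint τ σ)
    (hli : LinearIndepOn F rep ((τ ∪ σ : Finset (PMVector F n)) : Set (PMVector F n)))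
    (hbad : ¬IsDetOne (τ ∪ σ)) :
    ∃ z : PMVector F n, ∀ v ∈ τ, insert z (τ.erase v) ∈ (detLink σ).faces := by
  have hcard : (τ ∪ σ).card = n := by
    by_contra h
    exact hbad (isDetOne_of_card_ne hli h)
  let e : Fin n ≃ ↥(τ ∪ σ) := (Finset.equivFinOfCardEq hcard).symm
  let W : Fin n → Fin n → F := fun j => rep (e j).1
  have hW : LinearIndependent F W := LinearIndependent.comp hli e e.injective
  set d : F := Matrix.detRowAlternating W with hd
  have hd0 : d ≠ 0 := by
    have h1 := (Matrix.linearIndependent_rows_iff_isUnit (A := Matrix.of W)).1 hW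
    exact ((Matrix.isUnit_iff_isUnit_det _).1 h1).ne_zero
  let J : Finset (Fin n) := Finset.univ.filter fun j => (e j).1 ∈ τ
  -- In the determinant with `zv` in place `j₀ ∈ J`, only the summand of `W j₀` survives and
  -- contributes `d⁻¹ * d = 1`. Hence one vector works for all elements of `τ` at once.
  let zv : Fin n → F := ∑ j ∈ J, d⁻¹ • W j
  have hdet : ∀ j₀ ∈ J, Matrix.detRowAlternating (Function.update W j₀ zv) = 1 := by
    intro j₀ hj₀
    rw [AlternatingMap.map_update_sum, Finset.sum_eq_single_of_mem j₀ hj₀]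
    · rw [AlternatingMap.map_update_smul, Function.update_eq_self, ← hd, smul_eq_mul,
        inv_mul_cancel₀ hd0]
    · intro j _ hne
      rw [AlternatingMap.map_update_smul, AlternatingMap.map_update_self _ _ hne.symm, smul_zero]
  have hJ : ∀ v ∈ τ, ∃ j₀ ∈ J, (e j₀).1 = v := by
    intro v hv
    refine ⟨e.symm ⟨v, Finset.mem_union_left _ hv⟩, ?_, by simp⟩
    simp [J, hv]
  have hz0 : zv ≠ 0 := by
    obtain ⟨v, hv⟩ := hne
    obtain ⟨j₀, hj₀, -⟩ := hJ v hv
    intro h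
    have h1 := hdet j₀ hj₀
    rw [h, AlternatingMap.map_update_zero] at h1
    exact zero_ne_one h1
  refine ⟨pm zv hz0, fun v hv => ?_⟩
  obtain ⟨j₀, hj₀, hev⟩ := hJ v hv
  let u : Fin n → PMVector F n := Function.update (fun j => (e j).1) j₀ (pm zv hz0)
  have hu : (fun j => rep (u j)) = Function.update W j₀ (rep (pm zv hz0)) := by
    ext1 j
    by_cases h : j = j₀
    · subst h; simp [u]
    · simp [u, h, W]
  have hsign : IsSign (Matrix.detRowAlternating fun j => rep (u j)) := by
    rw [hu]
    have h1 : rep (pm zv hz0) ∈ (pm zv hz0).1 := rep_mem _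
    rcases h1 with h | h
    · rw [h, hdet j₀ hj₀]
      exact Or.inl rfl
    · rw [Set.mem_singleton_iff.1 h, AlternatingMap.map_update_neg, hdet j₀ hj₀]
      exact Or.inr rfl
  have himage : Finset.univ.image u = insert (pm zv hz0) (τ.erase v) ∪ σ := by
    ext a
    simp only [Finset.mem_image, Finset.mem_univ, true_and, Finset.mem_union, Finset.mem_insert,
      Finset.mem_erase]
    constructor
    · rintro ⟨j, rfl⟩
      by_cases h : j = j₀
      · subst h; simp [u]
      · have h1 : (e j).1 ≠ v := fun h2 => h (e.injective (Subtype.ext (h2.trans hev.symm)))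
        have h2 := Finset.mem_union.1 (e j).2
        have h3 : u j = (e j).1 := by simp [u, h]
        rw [h3]
        tauto
    · have key : ∀ b, b ∈ τ ∪ σ → b ≠ v → ∃ j, u j = b := by
        intro b hb hbv
        refine ⟨e.symm ⟨b, hb⟩, ?_⟩
        have : e.symm ⟨b, hb⟩ ≠ j₀ := by
          intro h
          apply hbv
          rw [← hev, ← h]
          simp
        simp [u, this]
      rintro ((rfl | ⟨h1, h2⟩) | h)
      · exact ⟨j₀, by simp [u]⟩
      · exact key a (Finset.mem_union_left _ h2) h1
      · refine key a (Finset.mem_union_right _ h) ?_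
        rintro rfl
        exact Finset.disjoint_left.1 hdis hv h
  obtain ⟨hinj, hD⟩ := isDetOne_of_det hsign himage
  refine ⟨by simp, ?_, hD⟩
  rw [Finset.disjoint_insert_left]
  refine ⟨fun h => ?_, Finset.disjoint_of_subset_left (Finset.erase_subset _ _) hdis⟩
  -- If the new vertex were in `σ`, then `u` would take this value at a second index besides `j₀`,
  -- contradicting injectivity.
  have h1 : e.symm ⟨_, Finset.mem_union_right _ h⟩ ≠ j₀ := by
    intro h1
    have h2 : pm zv hz0 = v := by
      rw [← hev, ← h1]
      simp
    exact Finset.disjoint_left.1 hdis hv (h2 ▸ h)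
  exact h1 (hinj (by simp [u, h1]))

/-- The link of a `k`-element partial `±`-basis in the complex of determinant-`1` partial `±`-bases
of `F^n` is `(n - k - 2)`-connected. -/
theorem conn_detLink {σ : Finset (PMVector F n)}
    (hσ : LinearIndepOn F rep (σ : Set (PMVector F n))) :
    (detLink σ).Conn ((n : ℤ) - σ.card - 2) := by
  classical
  have hK : ((indepComplex F (rep : PMVector F n → Fin n → F)).link σ).Conn
      ((n : ℤ) - σ.card - 2) := by
    rw [link_indepComplex _ hσ]
    refine (conn_indepComplex _ ?_).mono ?_
    · rw [Set.range_comp, Submodule.span_image, span_range_rep, Submodule.map_top,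
        Submodule.range_mkQ]
    · have hfr : Module.finrank F (Submodule.span F (rep '' (σ : Set (PMVector F n)))) =
          σ.card := by
        have := finrank_span_eq_card (R := F) (b := fun t : σ => rep t.1) hσ
        rw [Fintype.card_coe] at this
        rw [← this, Set.image_eq_range]
        rfl
      have hq := Submodule.finrank_quotient_add_finrank
        (Submodule.span F (rep '' (σ : Set (PMVector F n))))
      rw [hfr, Module.finrank_fin_fun] at hq
      omega
  -- The simplices lost are those completing `σ` to a full basis of the wrong determinant: maximal
  -- by cardinality, and coned off by `exists_cone_vertex`.
  refine hK.of_retract ?_ ?_ ?_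
  · rintro τ ⟨h1, h2, h3⟩
    exact mem_link_iff.2 ⟨h1, h2, h1.mono Finset.subset_union_left, h3.linearIndepOn⟩
  · intro τ hτ hL s hs' hs
    obtain ⟨h1, h2, -, h3⟩ := mem_link_iff.1 hτ
    obtain ⟨h1', h2', -, h3'⟩ := mem_link_iff.1 hs'
    have hcard : (τ ∪ σ).card = n := by
      by_contra h
      exact hL ⟨h1, h2, isDetOne_of_card_ne h3 h⟩
    have h4 : τ ∪ σ = s ∪ σ := Finset.eq_of_subset_of_card_le (Finset.union_subset_union_left hs)
      ((card_le_of_linearIndepOn h3').trans hcard.ge)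
    refine Finset.Subset.antisymm (fun v hv => ?_) hs
    have h5 : v ∈ τ ∪ σ := by rw [h4]; exact Finset.mem_union_left _ hv
    exact (Finset.mem_union.1 h5).resolve_right fun h => Finset.disjoint_left.1 h2' hv h
  · intro τ hτ hL
    obtain ⟨h1, h2, -, h3⟩ := mem_link_iff.1 hτ
    exact exists_cone_vertex h1 h2 h3 fun h => hL ⟨h1, h2, h⟩

end PMBasis

/-! ### Augmented links. -/

namespace PMBasis

open PreAbstractSimplicialComplex

variable {F : Type*} [Field F] {n : ℕ}

open Classical in
/-- Three distinct `±`-vectors with representatives of sum zero. -/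
def IsTriple (t : Finset (PMVector F n)) : Prop :=
  ∃ a₀ a₁ a₂, a₀ ≠ a₁ ∧ a₀ ≠ a₂ ∧ a₁ ≠ a₂ ∧ t = {a₀, a₁, a₂} ∧
    ∃ x₀ ∈ a₀.1, ∃ x₁ ∈ a₁.1, ∃ x₂ ∈ a₂.1, x₀ + x₁ + x₂ = 0

lemma neg_mem_of_mem {a : PMVector F n} {x : Fin n → F} (hx : x ∈ a.1) : -x ∈ a.1 := by
  rw [mem_iff] at hx ⊢
  rcases hx with rfl | rfl <;> simp

-- With the signs absorbed into the representatives, the relation is symmetric, so any of the three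
-- `±`-vectors can play the role of `±v₀`.
open Classical in
lemma IsTriple.rotate {a : PMVector F n} {t : Finset (PMVector F n)} (ht : IsTriple t)
    (ha : a ∈ t) : ∃ a₁ a₂, a ≠ a₁ ∧ a ≠ a₂ ∧ a₁ ≠ a₂ ∧ t = {a, a₁, a₂} ∧
      ∃ x ∈ a.1, ∃ x₁ ∈ a₁.1, ∃ x₂ ∈ a₂.1, x + x₁ + x₂ = 0 := by
  obtain ⟨a₀, a₁, a₂, h01, h02, h12, rfl, x₀, h₀, x₁, h₁, x₂, h₂, h⟩ := ht
  simp only [Finset.mem_insert, Finset.mem_singleton] at ha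
  rcases ha with rfl | rfl | rfl
  · exact ⟨a₁, a₂, h01, h02, h12, rfl, x₀, h₀, x₁, h₁, x₂, h₂, h⟩
  · refine ⟨a₀, a₂, h01.symm, h12, h02, ?_, x₁, h₁, x₀, h₀, x₂, h₂, by rw [← h]; abel⟩
    exact Finset.insert_comm _ _ _
  · refine ⟨a₀, a₁, h02.symm, h12.symm, h01, ?_, x₂, h₂, x₀, h₀, x₁, h₁, by rw [← h]; abel⟩
    ext b
    simp only [Finset.mem_insert, Finset.mem_singleton]
    tauto

lemma IsTriple.not_linearIndepOn {t : Finset (PMVector F n)} (ht : IsTriple t)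
    {s : Set (PMVector F n)} (hs : (t : Set (PMVector F n)) ⊆ s) : ¬LinearIndepOn F rep s := by
  classical
  intro hli
  obtain ⟨a₀, a₁, a₂, h01, h02, h12, rfl, x₀, h₀, x₁, h₁, x₂, h₂, h⟩ := ht
  have hli' := hli.mono hs
  rw [Finset.coe_insert, linearIndepOn_insert (by simp [h01, h02])] at hli'
  refine hli'.2 ?_
  have hx : ∀ {a : PMVector F n} {x}, x ∈ a.1 → a ∈ ({a₁, a₂} : Finset (PMVector F n)) →
      x ∈ Submodule.span F (rep '' (({a₁, a₂} : Finset (PMVector F n)) : Set (PMVector F n))) := by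
    intro a x hx ha
    have h1 : rep a ∈ Submodule.span F
        (rep '' (({a₁, a₂} : Finset (PMVector F n)) : Set (PMVector F n))) :=
      Submodule.subset_span ⟨a, ha, rfl⟩
    rcases (mem_iff a).1 hx with rfl | rfl
    exacts [h1, neg_mem h1]
  have h3 : -x₀ ∈ Submodule.span F
      (rep '' (({a₁, a₂} : Finset (PMVector F n)) : Set (PMVector F n))) := by
    rw [show -x₀ = x₁ + x₂ by rw [neg_eq_iff_add_eq_zero, ← add_assoc, h]]
    exact add_mem (hx h₁ (by simp)) (hx h₂ (by simp))
  rcases (mem_iff a₀).1 h₀ with rfl | rfl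
  · simpa using h3
  · simpa using h3

-- The exchange property makes the three dependent `±`-vectors interchangeable: deleting any one of
-- them leaves a determinant-`1` partial `±`-basis.
open Classical in
lemma IsAugmentedDetOne.exists_triple {s : Finset (PMVector F n)} (hs : IsAugmentedDetOne s) :
    ∃ t ⊆ s, IsTriple t ∧ ∀ a ∈ t, IsDetOne (s.erase a) := by
  obtain ⟨a₀, h₀, a₁, h₁, a₂, h₂, h₁₂, hD, v₀, hv₀, v₁, hv₁, v₂, hv₂, c, hc, d, hd, e⟩ := hs
  have hD1 := hD.exchange h₀ h₁ h₂ h₁₂ hv₀ hv₁ hv₂ hc e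
  have hD2 := hD.exchange h₀ h₂ h₁ h₁₂.symm hv₀ hv₂ hv₁ hd (by rw [e, add_comm])
  refine ⟨{a₀, a₁, a₂}, ?_, ⟨a₀, a₁, a₂, (Finset.ne_of_mem_erase h₁).symm,
    (Finset.ne_of_mem_erase h₂).symm, h₁₂, rfl, -v₀, neg_mem_of_mem hv₀, c • v₁,
    mem_of_sign hv₁ hc, d • v₂, mem_of_sign hv₂ hd, by rw [e]; abel⟩, ?_⟩
  · intro a ha
    simp only [Finset.mem_insert, Finset.mem_singleton] at ha
    rcases ha with rfl | rfl | rfl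
    exacts [h₀, Finset.mem_of_mem_erase h₁, Finset.mem_of_mem_erase h₂]
  · intro a ha
    simp only [Finset.mem_insert, Finset.mem_singleton] at ha
    rcases ha with rfl | rfl | rfl
    exacts [hD, hD1, hD2]

open Classical in
lemma IsTriple.isAugmentedDetOne {s t : Finset (PMVector F n)} (ht : IsTriple t) (hts : t ⊆ s)
    {a : PMVector F n} (ha : a ∈ t) (hs : IsDetOne (s.erase a)) : IsAugmentedDetOne s := by
  obtain ⟨a₁, a₂, h01, h02, h12, rfl, x₀, h₀, x₁, h₁, x₂, h₂, h⟩ := ht.rotate ha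
  refine ⟨a, hts ha, a₁, Finset.mem_erase.2 ⟨h01.symm, hts (by simp)⟩, a₂,
    Finset.mem_erase.2 ⟨h02.symm, hts (by simp)⟩, h12, hs, -x₀, neg_mem_of_mem h₀, x₁, h₁, x₂, h₂,
    1, by simp, 1, by simp, ?_⟩
  rw [one_smul, one_smul, neg_eq_iff_add_eq_zero, ← add_assoc, h]

lemma span_iUnion_eq (σ : Finset (PMVector F n)) :
    Submodule.span F (⋃ a ∈ σ, a.1) = Submodule.span F (rep '' (σ : Set (PMVector F n))) := by
  apply le_antisymm
  · rw [Submodule.span_le]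
    intro x hx
    simp only [Set.mem_iUnion] at hx
    obtain ⟨a, ha, hx⟩ := hx
    have h1 : rep a ∈ Submodule.span F (rep '' (σ : Set (PMVector F n))) :=
      Submodule.subset_span ⟨a, ha, rfl⟩
    rcases (mem_iff a).1 hx with rfl | rfl
    exacts [h1, neg_mem h1]
  · apply Submodule.span_mono
    rintro _ ⟨a, ha, rfl⟩
    simp only [Set.mem_iUnion]
    exact ⟨a, ha, rep_mem a⟩

lemma notMem_span_of_linearIndepOn {σ : Finset (PMVector F n)} {s : Set (PMVector F n)}
    (hs : LinearIndepOn F rep s) (hσ : (σ : Set (PMVector F n)) ⊆ s) {a : PMVector F n}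
    (ha : a ∈ s) (haσ : a ∉ σ) : ∀ w ∈ a.1, w ∉ Submodule.span F (⋃ a' ∈ σ, a'.1) := by
  intro w hw h
  rw [span_iUnion_eq] at h
  have h1 := (linearIndepOn_insert (a := a) (s := (σ : Set (PMVector F n))) (by simpa using haσ)).1
    (hs.mono (Set.insert_subset ha hσ))
  refine h1.2 ?_
  rcases (mem_iff a).1 hw with rfl | rfl
  · exact h
  · simpa using h

open Classical in
lemma mem_augmentedLink_iff {σ τ : Finset (PMVector F n)} :
    τ ∈ (augmentedLink σ).faces ↔ τ.Nonempty ∧ Disjoint τ σ ∧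
      (IsDetOne (τ ∪ σ) ∨ IsAugmentedDetOne (τ ∪ σ)) ∧
      ∀ a ∈ τ, ∀ w ∈ a.1, w ∉ Submodule.span F (⋃ a' ∈ σ, a'.1) := by
  change τ ∈ ((BDA F n).link σ).faces ∧ _ ↔ _
  rw [mem_link_iff]
  constructor
  · rintro ⟨⟨h1, h2, h3⟩, h4⟩
    exact ⟨h1, h2, h3.2, h4⟩
  · rintro ⟨h1, h2, h3, h4⟩
    exact ⟨⟨h1, h2, h1.mono Finset.subset_union_left, h3⟩, h4⟩

/-- The augmented link of a `k`-element partial `±`-basis of `F^n` is `(n - k - 2)`-connected. -/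
theorem conn_augmentedLink {σ : Finset (PMVector F n)}
    (hσ : LinearIndepOn F rep (σ : Set (PMVector F n))) :
    (augmentedLink σ).Conn ((n : ℤ) - σ.card - 2) := by
  classical
  have hLK : (detLink σ).faces ⊆ (augmentedLink σ).faces := by
    rintro τ ⟨h1, h2, h3⟩
    refine mem_augmentedLink_iff.2 ⟨h1, h2, Or.inl h3, fun a ha => ?_⟩
    exact notMem_span_of_linearIndepOn h3.linearIndepOn (by simp)
      (by simp [ha]) (Finset.disjoint_left.1 h2 ha)
  have htriple : ∀ s ∈ (augmentedLink σ).faces, s ∉ (detLink σ).faces →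
      ∃ t ⊆ s ∪ σ, IsTriple t ∧ (∀ a ∈ t, IsDetOne ((s ∪ σ).erase a)) ∧
        ∀ c, IsCore (augmentedLink σ) (detLink σ) c → c ⊆ s → c = t \ σ := by
    intro s hs hsL
    obtain ⟨h1, h2, h3, h4⟩ := mem_augmentedLink_iff.1 hs
    have h5 : IsAugmentedDetOne (s ∪ σ) := h3.resolve_left fun h => hsL ⟨h1, h2, h⟩
    obtain ⟨t, hts, ht, htD⟩ := h5.exists_triple
    refine ⟨t, hts, ht, htD, fun c hc hcs => ?_⟩
    have hcσ := (mem_augmentedLink_iff.1 hc.1).2.1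
    -- If `c` missed an element `a` of the triple outside `σ`, then `c ∪ σ` would lie in `s ∪ σ`
    -- without `a`, which has determinant `1` in the partial sense, so `c` would not be a core.
    -- Conversely `t \ σ` is already outside `detLink σ`, since the triple is dependent; minimality
    -- gives equality.
    have hsub : t \ σ ⊆ c := by
      intro a ha
      rw [Finset.mem_sdiff] at ha
      by_contra hac
      refine hc.2.1 ⟨hc.nonempty, hcσ, (htD a ha.1).mono ?_⟩
      refine Finset.subset_erase.2 ⟨Finset.union_subset_union_left hcs, ?_⟩
      simp [hac, ha.2]
    have hne : (t \ σ).Nonempty := by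
      rw [Finset.sdiff_nonempty]
      exact fun h => ht.not_linearIndepOn (by simpa using h) hσ
    refine (hc.2.2 _ hsub (((augmentedLink σ).isRelLowerSet_faces hc.1).2 hsub hne) ?_).symm
    rintro ⟨-, -, h⟩
    exact ht.not_linearIndepOn (by simp) h.linearIndepOn
  refine Conn.glue hLK ?_ (conn_detLink hσ) ?_
  · intro s hs c c' hc hc' hcs hcs'
    obtain ⟨t, -, -, -, h⟩ := htriple s hs (notMem_faces_of_subset hc.nonempty hc.2.1 hcs)
    rw [h c hc hcs, h c' hc' hcs']
  · intro c hc
    obtain ⟨hcne, hcσ, -, hcw⟩ := mem_augmentedLink_iff.1 hc.1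
    obtain ⟨t, hts, ht, htD, hct⟩ := htriple c hc.1 hc.2.1
    have hct := hct c hc subset_rfl
    obtain ⟨a, hac⟩ := hcne
    have hat : a ∈ t := by
      rw [hct] at hac
      exact (Finset.mem_sdiff.1 hac).1
    have haσ : a ∉ σ := Finset.disjoint_left.1 hcσ hac
    have hσs : σ ⊆ (c ∪ σ).erase a := Finset.subset_erase.2 ⟨Finset.subset_union_right, haσ⟩
    have herase : ∀ τ : Finset (PMVector F n), a ∉ τ →
        (τ ∪ c ∪ σ).erase a = τ ∪ (c ∪ σ).erase a := by
      intro τ haτ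
      ext b
      simp only [Finset.mem_erase, Finset.mem_union]
      constructor
      · tauto
      · rintro (h | h)
        · exact ⟨fun hb => haτ (hb ▸ h), Or.inl (Or.inl h)⟩
        · tauto
    -- Any `a ∈ c` belongs to the triple. So `τ` can be added to `c ∪ σ` in the augmented complex
    -- exactly when it can be added to the determinant-`1` partial basis left after deleting `a`.
    have hlink : (augmentedLink σ).link c = detLink ((c ∪ σ).erase a) := by
      ext τ
      rw [mem_link_iff]
      constructor
      · rintro ⟨hτ, hτc, hK⟩
        have haτ : a ∉ τ := fun h => Finset.disjoint_left.1 hτc h hac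
        obtain ⟨t', -, -, h1, h2⟩ := htriple _ hK
          (notMem_faces_of_subset hc.nonempty hc.2.1 Finset.subset_union_right)
        have h3 := h2 c hc Finset.subset_union_right
        have h4 : a ∈ t' := by
          rw [h3] at hac
          exact (Finset.mem_sdiff.1 hac).1
        have h5 := h1 a h4
        rw [herase τ haτ] at h5
        refine ⟨hτ, ?_, h5⟩
        refine Finset.disjoint_of_subset_right (Finset.erase_subset _ _) ?_
        rw [Finset.disjoint_union_right]
        exact ⟨hτc, Finset.disjoint_of_subset_left Finset.subset_union_left
          (mem_augmentedLink_iff.1 hK).2.1⟩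
      · rintro ⟨hτ, hdis, hD⟩
        have haτ : a ∉ τ := by
          intro h
          refine hc.2.1 ⟨hc.nonempty, hcσ, hD.mono ?_⟩
          intro b hb
          by_cases hba : b = a
          · exact Finset.mem_union_left _ (hba ▸ h)
          · exact Finset.mem_union_right _ (Finset.mem_erase.2 ⟨hba, hb⟩)
        have hτc : Disjoint τ c := by
          rw [Finset.disjoint_left]
          intro b hb hbc
          exact Finset.disjoint_left.1 hdis hb (Finset.mem_erase.2
            ⟨fun h => haτ (h ▸ hb), Finset.mem_union_left _ hbc⟩)
        have hτσ : Disjoint τ σ := Finset.disjoint_of_subset_right hσs hdis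
        refine ⟨hτ, hτc, mem_augmentedLink_iff.2 ⟨hτ.mono Finset.subset_union_left,
          Finset.disjoint_union_left.2 ⟨hτσ, hcσ⟩, Or.inr ?_, ?_⟩⟩
        · refine ht.isAugmentedDetOne (hts.trans ?_) hat ?_
          · exact Finset.union_subset_union_left Finset.subset_union_right
          · rw [herase τ haτ]
            exact hD
        · intro b hb
          rcases Finset.mem_union.1 hb with hb | hb
          · refine notMem_span_of_linearIndepOn hD.linearIndepOn ?_ (by simp [hb])
              (Finset.disjoint_left.1 hτσ hb)
            rw [Finset.coe_subset]
            exact hσs.trans Finset.subset_union_right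
          · exact hcw b hb
    rw [hlink]
    -- The deleted element makes the cardinality `|c| + |σ| - 1`, so the link is even one degree
    -- more connected than the gluing requires.
    refine (conn_detLink (htD a hat).linearIndepOn).mono ?_
    rw [Finset.card_erase_of_mem (Finset.mem_union_left _ hac), Finset.card_union_of_disjoint hcσ]
    have := hc.nonempty.card_pos
    omega

lemma mem_pm {v : Fin n → F} (hv : v ≠ 0) : v ∈ (pm v hv).1 := Or.inl rfl

/-- The chosen representatives differ from the given vectors only by signs. -/
lemma linearIndependent_rep_pm {ι : Type*} {v : ι → Fin n → F} (hv : LinearIndependent F v) :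
    LinearIndependent F fun i => rep (pm (v i) (hv.ne_zero i)) := by
  choose c hc using fun i => exists_unit_smul (rep_mem (pm (v i) (hv.ne_zero i)))
    (mem_pm (hv.ne_zero i))
  have h1 := hv.units_smul c
  convert h1 using 1
  ext1 i
  rw [hc i]
  rfl

lemma stdSimplexPM_spec (F : Type*) [Field F] (n m : ℕ) :
    LinearIndepOn F rep (stdSimplexPM F n m : Set (PMVector F (n + m))) ∧
      (stdSimplexPM F n m).card = m := by
  classical
  have hv : LinearIndependent F fun i : Fin m =>
      (Pi.single (Fin.castLE (Nat.le_add_left m n) i) (1 : F) : Fin (n + m) → F) := by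
    have h1 := (Pi.basisFun F (Fin (n + m))).linearIndependent.comp
      (Fin.castLE (Nat.le_add_left m n)) (Fin.castLE_injective _)
    convert h1 using 1
    ext1 i
    simp
  have h2 := linearIndependent_rep_pm hv
  have hinj : Function.Injective fun i : Fin m =>
      pm (Pi.single (Fin.castLE (Nat.le_add_left m n) i) (1 : F)) (hv.ne_zero i) :=
    fun i j h => h2.injective (congrArg rep h)
  constructor
  · have : (stdSimplexPM F n m : Set (PMVector F (n + m))) = Set.range fun i : Fin m =>
        pm (Pi.single (Fin.castLE (Nat.le_add_left m n) i) (1 : F)) (hv.ne_zero i) := by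
      simp [stdSimplexPM]
    rw [this]
    exact (linearIndepOn_range_iff hinj rep).2 h2
  · rw [stdSimplexPM, Finset.card_image_of_injective _ hinj]
    simp

end PMBasis

theorem proposition2p11 (F : Type*) [Field F] (n m : ℕ) :
    IsHighlyConnected ((n : ℤ) - 2) (PMBasis.BDARel F n m).Realization := by
  obtain ⟨h1, h2⟩ := PMBasis.stdSimplexPM_spec F n m
  refine ((PMBasis.conn_augmentedLink h1).mono ?_).isHighlyConnected
  rw [h2]
  push_cast
  omega
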